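/- **Setting.** Let $n,h,D\ge 0$ and $K\ge 1$ be integers, and let $\mathcal H_1,\dots,\mathcal H_D$ be operators on $\mathbb C^{2^n}\otimes\mathbb C^{2^h}\otimes\mathbb C^2$ (input, hidden units, label qubit) that are both Hermitian and unitary. For $\omega\in\mathbb R^D$ put $\mathcal H(\omega)=\sum_{i=1}^D\omega_i\mathcal H_i$. The training data are unit vectors $|v_k\rangle\in\mathbb C^{2^n}$ and $|\ell_k\rangle\in\mathbb C^2$, $k=1,\dots,K$, such that $P_{\ell_k}=1\otimes 1\otimes|\ell_k\rangle\langle\ell_k|$ commutes with every $\mathcal H_i$. Let $H_k=\lambda|v_k\rangle\langle v_k|\otimes 1+\mathcal H(\omega)$ and $$f(\omega)=\lim_{\lambda\to\infty}\frac1K\sum_{k=1}^K\mathrm{Tr}\Big(\frac{P_{\ell_k}e^{H_k}}{\mathrm{Tr}\,e^{H_k}}\Big),$$ and let $H'_k(\omega)$ be the operator on $\mathbb C^{2^h}\otimes\mathbb C^2$ with matrix entries $\langle v_k|\langle x|\mathcal H(\omega)|v_k\rangle|y\rangle$. **Query model.** A query algorithm is an adaptive quantum algorithm (arbitrary quantum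 operations and measurements with finitely many outcomes, classical control) that knows $\mathcal H_1,\dots,\mathcal H_D$ but has access to the training data only through two oracles: unitaries $F(k)$ with $F(k)|0\rangle=|v_k\rangle|\ell_k\rangle$, which may also be inverted, and $G_k$, which on request supplies a fresh copy of $e^{H'_k(\omega)}/\mathrm{Tr}\,e^{H'_k(\omega)}$ for weights $\omega$ of the algorithm's choice. Each use of $F(k)$, $F(k)^{-1}$ or $G_k$ is one query; queries are counted in the worst case over measurement outcomes. **Theorem.** Let $0<\mu<L$ and $\mathcal L\ge 0$. There are $C>0$ and $c\in\mathbb N$, depending only on $\mu,L,\mathcal L$, such that the following holds for all $n,h,K,D$ and $\mathcal H_1,\dots,\mathcal H_D$ as above, every sign $s\in\{1,-1\}$, every closed convex set $A\subseteq\mathbb R^D$ of admissible weights (for instance $A=\mathbb R^D$), every $\omega_0\in A$, $\epsilon>0$ and $R\ge 0$. There is a query algorithm, chosen before the training data and the oracles, that makes at most $$C\,\frac{D^2}{\epsilon^2}\Big(\frac{R}{\epsilon}\Big)^{\frac{\log(1+\mathcal L/L)}{\log(L/(L-\mu))}}\Big(1+\log\big(1+\tfrac R\epsilon\big)\Big)^{c}$$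 queries and outputs $\omega'$ with $\|\omega'-\omega^*\|\le\epsilon$ with probability at least $2/3$, for all training data, all oracles as above, every compact region $S$ and every $\omega^*\in A$ with $\|\omega^*-\omega_0\|\le R$ and $\{\omega\in A:\|\omega-\omega^*\|\le R\}\subseteq S$ such that, for $g=s f$: 1. $\omega^*$ minimizes $g$ on $S$; 2. $\frac\mu2\|x'-x\|^2\le g(x')-g(x)-\nabla g(x)\cdot(x'-x)\le\frac L2\|x'-x\|^2$ for all $x,x'\in S$; 3. $\|\nabla f(\omega)-\nabla f(\omega')\|\le\mathcal L\|\omega-\omega'\|$ for all $\omega,\omega'\in S$. (The sign $s=-1$ is the case of maximizing the accuracy $f$, with $-f$ strongly convex. The choice $R=\|\omega^*-\omega_0\|$ gives the bound $\widetilde O\big(\frac{D^2}{\epsilon^2}(\|\omega^*-\omega_0\|/\epsilon)^{\log(1+\mathcal L/L)/\log(L/(L-\mu))}\big)$, with only a polylogarithmic factor suppressed.) -/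

import Mathlib

open Filter Topology
open scoped Kronecker Matrix

namespace HarmonyLearning

noncomputable section

/-- Basis labels of the input register `ℂ^(2^n)`. -/
abbrev Inp (n : ℕ) : Type := Fin (2 ^ n)

/-- Basis labels of the hidden units together with the label qubit, `ℂ^(2^h) ⊗ ℂ^2`. -/
abbrev HidLab (h : ℕ) : Type := Fin (2 ^ h) × Fin 2

/-- The weights `ω ∈ ℝ^D`, with the Euclidean norm. -/
abbrev Weights (D : ℕ) : Type := EuclideanSpace ℝ (Fin D)

/-- Operators on `ℂ^(2^n) ⊗ ℂ^(2^h) ⊗ ℂ^2`. -/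
abbrev Op (n h : ℕ) : Type := Matrix (Inp n × HidLab h) (Inp n × HidLab h) ℂ

/-- The rank one operator `|v⟩⟨v|`. -/
def ketbra {ι : Type} (v : EuclideanSpace ℂ ι) : Matrix ι ι ℂ :=
  Matrix.of fun i j => v i * star (v j)

/-- The Harmony operator `𝓗(ω) = ∑ i, ω i • 𝓗_i`. -/
def harmony {n h D : ℕ} (Hs : Fin D → Op n h) (ω : Weights D) : Op n h :=
  ∑ i, ((ω i : ℝ) : ℂ) • Hs i

/-- The penalized operator `t |v⟩⟨v| ⊗ 1 + 𝓗`. -/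
def penalized {n h : ℕ} (t : ℝ) (v : EuclideanSpace ℂ (Inp n)) (H : Op n h) : Op n h :=
  (t : ℂ) • (ketbra v ⊗ₖ (1 : Matrix (HidLab h) (HidLab h) ℂ)) + H

/-- The projector `1 ⊗ 1 ⊗ |ℓ⟩⟨ℓ|` that tests the label qubit. -/
def labelProj (n h : ℕ) (l : EuclideanSpace ℂ (Fin 2)) : Op n h :=
  (1 : Matrix (Inp n) (Inp n) ℂ) ⊗ₖ ((1 : Matrix (Fin (2 ^ h)) (Fin (2 ^ h)) ℂ) ⊗ₖ ketbra l)

/-- The Gibbs state `e^A / Tr e^A`. -/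
def gibbs {ι : Type} [Fintype ι] [DecidableEq ι] (A : Matrix ι ι ℂ) : Matrix ι ι ℂ :=
  (NormedSpace.exp A).trace⁻¹ • NormedSpace.exp A

/-- The conditional Harmony operator, with entries `⟨v|⟨x| 𝓗 |v⟩|y⟩`. -/
def conditional {n h : ℕ} (v : EuclideanSpace ℂ (Inp n)) (H : Op n h) :
    Matrix (HidLab h) (HidLab h) ℂ :=
  Matrix.of fun x y => ∑ a, ∑ b, star (v a) * H (a, x) (b, y) * v b

/-- The supervised training objective: the classification accuracy
`lim_{t → ∞} (1/K) ∑ k, Tr (P_{ℓ_k} e^{H_k} / Tr e^{H_k})`, `H_k = t |v_k⟩⟨v_k| ⊗ 1 + 𝓗(ω)`. -/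
def objective {n h K D : ℕ} (Hs : Fin D → Op n h) (v : Fin K → EuclideanSpace ℂ (Inp n))
    (l : Fin K → EuclideanSpace ℂ (Fin 2)) (ω : Weights D) : ℝ :=
  limUnder atTop fun t : ℝ =>
    (1 / (K : ℝ)) * ∑ k, ((labelProj n h (l k) *
      gibbs (penalized t (v k) (harmony Hs ω))).trace).re

/-- `g` is `μ`-strongly convex and `L`-smooth on `S`, in the form
`(g x' - g x - ∇g x · (x' - x)) ‖x' - x‖⁻² ∈ [μ/2, L/2]` for distinct `x, x' ∈ S`. -/
def StronglyConvexSmoothOn {D : ℕ} (μ L : ℝ) (S : Set (Weights D)) (g : Weights D → ℝ) : Prop :=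
  ∀ x ∈ S, ∀ x' ∈ S,
    μ / 2 * ‖x' - x‖ ^ 2 ≤ g x' - g x - inner ℝ (gradient g x) (x' - x) ∧
    g x' - g x - inner ℝ (gradient g x) (x' - x) ≤ L / 2 * ‖x' - x‖ ^ 2

/-- The condition on a training-data oracle: each `F k` is unitary on `ℂ^(2^n) ⊗ ℂ^2` and maps
`|0⟩` to `|v_k⟩|ℓ_k⟩`. -/
def IsDataOracle {n K : ℕ} (v : Fin K → EuclideanSpace ℂ (Inp n))
    (l : Fin K → EuclideanSpace ℂ (Fin 2))
    (F : Fin K → Matrix (Inp n × Fin 2) (Inp n × Fin 2) ℂ) : Prop :=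
  ∀ k, F k ∈ Matrix.unitaryGroup (Inp n × Fin 2) ℂ ∧
    F k *ᵥ Pi.single (0, 0) 1 = fun p => v k p.1 * l k p.2

/-- The state preparation oracle: it returns the Gibbs state of the `k`-th conditional Harmony
operator at weights `ω`. -/
def gibbsOracle {n h K D : ℕ} (Hs : Fin D → Op n h) (v : Fin K → EuclideanSpace ℂ (Inp n))
    (k : Fin K) (ω : Weights D) : Matrix (HidLab h) (HidLab h) ℂ :=
  gibbs (conditional (v k) (harmony Hs ω))

/-- Adaptive quantum query algorithms whose current quantum workspace is `ℂ^W`. An algorithm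
either stops with a classical output; or performs a quantum instrument (unitaries, adding and
discarding registers, measurements and coin flips are special cases) and continues according to
the outcome; or applies `F k` or its inverse to an `ℂ^(2^n) ⊗ ℂ^2` register; or asks for a fresh
copy of the Gibbs state with index `k` at weights `ω`. The oracles enter only through the
semantics below. -/
inductive QueryAlgorithm (n h K D : ℕ) : Type → Type 1
  | output {W : Type} [Fintype W] (ω : Weights D) : QueryAlgorithm n h K D W
  | instrument {W W' X : Type} [Fintype W] [DecidableEq W] [Fintype W'] [Fintype X]
      (M : X → Matrix W' W ℂ) (hM : ∑ x, (M x)ᴴ * M x = 1)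
      (next : X → QueryAlgorithm n h K D W') : QueryAlgorithm n h K D W
  | queryF {W : Type} [Fintype W] [DecidableEq W] (k : Fin K) (inverse : Bool)
      (next : QueryAlgorithm n h K D ((Inp n × Fin 2) × W)) :
      QueryAlgorithm n h K D ((Inp n × Fin 2) × W)
  | queryG {W : Type} (k : Fin K) (ω : Weights D)
      (next : QueryAlgorithm n h K D (HidLab h × W)) : QueryAlgorithm n h K D W

namespace QueryAlgorithm

/-- The number of oracle queries, in the worst case over the measurement outcomes. -/
def queries {n h K D : ℕ} : {W : Type} → QueryAlgorithm n h K D W → ℕ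
  | _, @output _ _ _ _ _ _ _ => 0
  | _, @instrument _ _ _ _ _ _ _ _ _ _ _ _ _ next => Finset.univ.sup fun x => queries (next x)
  | _, @queryF _ _ _ _ _ _ _ _ _ next => queries next + 1
  | _, @queryG _ _ _ _ _ _ _ next => queries next + 1

/-- The probability that the output lies in `E`, when the algorithm is run with oracles `F` and
`G` on the state `ρ` (weighted by `Tr ρ` if `ρ` is unnormalized). -/
def prob {n h K D : ℕ} (F : Fin K → Matrix (Inp n × Fin 2) (Inp n × Fin 2) ℂ)
    (G : Fin K → Weights D → Matrix (HidLab h) (HidLab h) ℂ) (E : Set (Weights D)) :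
    {W : Type} → QueryAlgorithm n h K D W → Matrix W W ℂ → ℝ
  | _, @output _ _ _ _ _ _ ω, ρ => E.indicator (fun _ => ρ.trace.re) ω
  | _, @instrument _ _ _ _ _ _ _ _ _ _ _ M _ next, ρ =>
      ∑ x, prob F G E (next x) (M x * ρ * (M x)ᴴ)
  | _, @queryF _ _ _ _ W _ _ k inverse next, ρ =>
      let U := (if inverse then (F k)ᴴ else F k) ⊗ₖ (1 : Matrix W W ℂ)
      prob F G E next (U * ρ * Uᴴ)
  | _, @queryG _ _ _ _ _ k ω next, ρ => prob F G E next (G k ω ⊗ₖ ρ)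

end QueryAlgorithm

end

end HarmonyLearning

/-! The limit of strong penalization replaces each Gibbs state by the Gibbs state of the compression
of `harmony Hs ω` to the range of `|v_k⟩ ⊗ 1` (`tendsto_gibbs_penalized`). Hence the objective is an
average of expectations of a label projector `P` in conditional Gibbs states (`objective_eq`). As
`P` commutes with the exponent, the trace formula `tracial_fderiv_exp` applies, and the partial
derivatives are the covariances `Tr(BρP) - Tr(Bρ) Tr(ρP)`.

Both terms of a covariance are traces of a unitary against `ρ ⊗ ρ ⊗ |v,ℓ⟩⟨v,ℓ|`, so a Hadamard test
estimates them. Drawing the training vector, the coordinate and the term at random gives an unbiased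
gradient sample of norm `2D` from three queries. The mean of `m` samples then misses the gradient by
more than `δ` with probability at most `(2D)²/(mδ²)`.

Projected gradient descent with step `μ/M²`, `M = μ + Lip`, contracts the distance to the optimum by
a factor `q < 1` depending only on `μ` and `Lip`, up to a term proportional to the gradient error
(`projected_step_norm_le`). With `δ` of order `ε`, a number `T` of steps of order `log(R/ε)` and
failure probability `1/(3T)` per step suffice. The cost `3mT` is of order `D²/ε²` times a squared
logarithm. The power of `R/ε` in the claimed bound is at least `1` when `ε < R`, so it is pure
slack. -/

namespace HarmonyLearning

noncomputable section

/-! ### Exponentials in Banach and C⋆-algebras -/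

section ExponentialEstimates

/-- A self-adjoint element bounded above by `c` has exponential of norm at most `e^c`. -/
theorem norm_exp_le_of_le_algebraMap {𝔸 : Type*} [CStarAlgebra 𝔸] [PartialOrder 𝔸]
    [StarOrderedRing 𝔸] {x : 𝔸} (hx : IsSelfAdjoint x) {c : ℝ} (h : x ≤ algebraMap ℝ 𝔸 c) :
    ‖NormedSpace.exp x‖ ≤ Real.exp c := by
  rw [← CFC.real_exp_eq_normedSpace_exp hx]
  refine norm_cfc_le (Real.exp_pos c).le fun r hr => ?_
  rw [Real.norm_eq_abs, abs_of_pos (Real.exp_pos r)]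
  exact Real.exp_le_exp.mpr ((le_algebraMap_iff_spectrum_le (ha := hx)).mp h r hr)

/-- If `T` almost intertwines `a` and `b`, then it almost intertwines their exponentials. -/
theorem norm_mul_exp_sub_exp_mul_le {𝔸 : Type*} [NormedRing 𝔸] [NormedAlgebra ℝ 𝔸]
    [CompleteSpace 𝔸] (T a b : 𝔸) {α β : ℝ}
    (ha : ∀ r ∈ Set.Icc (0 : ℝ) 1, ‖NormedSpace.exp (r • a)‖ ≤ α)
    (hb : ∀ r ∈ Set.Icc (0 : ℝ) 1, ‖NormedSpace.exp (r • b)‖ ≤ β) :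
    ‖T * NormedSpace.exp a - NormedSpace.exp b * T‖ ≤ β * ‖T * a - b * T‖ * α := by
  -- Duhamel interpolation from `e^b T` at `r = 0` to `T e^a` at `r = 1`: only the defect `T a - b
  -- T` survives in the derivative.
  have hderiv : ∀ r : ℝ, HasDerivAt
      (fun r : ℝ => NormedSpace.exp ((1 - r) • b) * T * NormedSpace.exp (r • a))
      (NormedSpace.exp ((1 - r) • b) * (T * a - b * T) * NormedSpace.exp (r • a)) r := by
    intro r
    have h1 := (hasDerivAt_exp_smul_const (𝕂 := ℝ) b (1 - r)).scomp r
      ((hasDerivAt_id r).const_sub 1)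
    have h2 := hasDerivAt_exp_smul_const' (𝕂 := ℝ) a r
    have h3 : HasDerivAt
        (fun r : ℝ => NormedSpace.exp ((1 - r) • b) * T * NormedSpace.exp (r • a)) _ r :=
      (h1.mul_const T).mul h2
    convert h3 using 1
    simp only [Function.comp_apply, neg_smul, one_smul]
    noncomm_ring
  have h := norm_image_sub_le_of_norm_deriv_le_segment_01'
    (f := fun r : ℝ => NormedSpace.exp ((1 - r) • b) * T * NormedSpace.exp (r • a))
    (fun r _ => (hderiv r).hasDerivWithinAt) (C := β * ‖T * a - b * T‖ * α) ?_
  · simpa using h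
  · intro r hr
    have h1 := hb (1 - r) ⟨by linarith [hr.2], by linarith [hr.1]⟩
    have h2 := ha r ⟨hr.1, hr.2.le⟩
    have h0 : 0 ≤ β := (norm_nonneg _).trans h1
    calc _ ≤ ‖NormedSpace.exp ((1 - r) • b)‖ * ‖T * a - b * T‖ * ‖NormedSpace.exp (r • a)‖ :=
          (norm_mul_le _ _).trans (mul_le_mul_of_nonneg_right (norm_mul_le _ _) (norm_nonneg _))
      _ ≤ _ := by gcongr

/-- Strong penalization: `e^{H - tQ} - e^{D - tQ} → 0` for a projection `Q`, where `D` is the part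
of `H` that is block diagonal with respect to `Q`. -/
theorem tendsto_exp_penalized_sub {𝔸 : Type*} [CStarAlgebra 𝔸] [PartialOrder 𝔸]
    [StarOrderedRing 𝔸] {H Q : 𝔸} (hH : IsSelfAdjoint H) (hQ : IsSelfAdjoint Q)
    (hQQ : Q * Q = Q) :
    Tendsto (fun t : ℝ => NormedSpace.exp (H - t • Q) -
      NormedSpace.exp ((1 - Q) * H * (1 - Q) + Q * H * Q - t • Q)) atTop (𝓝 0) := by
  set D : 𝔸 := (1 - Q) * H * (1 - Q) + Q * H * Q with hDdef
  have h1Q : IsSelfAdjoint (1 - Q) := (IsSelfAdjoint.one 𝔸).sub hQ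
  have hD : IsSelfAdjoint D := by
    refine IsSelfAdjoint.add ?_ ?_
    · have := hH.conjugate (1 - Q); rwa [h1Q.star_eq] at this
    · have := hH.conjugate Q; rwa [hQ.star_eq] at this
  have hQ0 : 0 ≤ Q := by
    have := star_mul_self_nonneg Q; rwa [hQ.star_eq, hQQ] at this
  -- The bound is uniform in `t`: since `Q ≥ 0`, the penalty only lowers the exponent.
  have bound : ∀ X : 𝔸, IsSelfAdjoint X → ∀ t : ℝ, 0 ≤ t → ∀ r ∈ Set.Icc (0 : ℝ) 1,
      ‖NormedSpace.exp (r • (X - t • Q))‖ ≤ Real.exp ‖X‖ := by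
    intro X hX t ht r hr
    have hsa : IsSelfAdjoint (r • (X - t • Q)) :=
      (IsSelfAdjoint.all r).smul (hX.sub ((IsSelfAdjoint.all t).smul hQ))
    have hle : r • (X - t • Q) ≤ algebraMap ℝ 𝔸 (r * ‖X‖) := by
      have h1 : X - t • Q ≤ algebraMap ℝ 𝔸 ‖X‖ :=
        (sub_le_self _ (smul_nonneg ht hQ0)).trans hX.le_algebraMap_norm_self
      have h2 := smul_le_smul_of_nonneg_left h1 hr.1
      rwa [Algebra.algebraMap_eq_smul_one, smul_smul, ← Algebra.algebraMap_eq_smul_one] at h2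
    refine (norm_exp_le_of_le_algebraMap hsa hle).trans (Real.exp_le_exp.mpr ?_)
    nlinarith [norm_nonneg X, hr.2]
  -- First-order perturbation theory: `S` solves `S Q - Q S = H - D`. So `1 + S/t` intertwines the
  -- two exponents up to an error of order `1/t`, although the exponents themselves differ by the
  -- fixed amount `H - D`.
  set S : 𝔸 := (1 - Q) * H * Q - Q * H * (1 - Q) with hS
  set E := S * H - D * S with hE
  have key : ∀ t : ℝ, 0 < t →
      (1 + t⁻¹ • S) * (H - t • Q) - (D - t • Q) * (1 + t⁻¹ • S) = t⁻¹ • E := by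
    intro t ht
    have hSQ : S * Q - Q * S = H - D := by
      have e1 : S * Q = (1 - Q) * H * Q := by
        rw [hS, sub_mul, mul_assoc _ Q Q, hQQ, mul_assoc _ (1 - Q) Q, sub_mul 1 Q Q, hQQ]; simp
      have e2 : Q * S = - (Q * H * (1 - Q)) := by
        rw [hS, mul_sub, ← mul_assoc, ← mul_assoc, ← mul_assoc, ← mul_assoc, mul_sub Q 1 Q, hQQ]
        simp
      rw [e1, e2, hDdef]; noncomm_ring
    have : (1 + t⁻¹ • S) * (H - t • Q) - (D - t • Q) * (1 + t⁻¹ • S) =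
        H - D - (S * Q - Q * S) + t⁻¹ • E := by
      simp only [hE, add_mul, mul_sub, sub_mul, mul_add, one_mul, mul_one, smul_mul_assoc,
        mul_smul_comm, smul_sub, smul_add, smul_smul, mul_inv_cancel₀ ht.ne',
        inv_mul_cancel₀ ht.ne', one_smul]
      abel
    rw [this, hSQ]; abel
  have hlim : Tendsto (fun t : ℝ => Real.exp ‖D‖ * (t⁻¹ * ‖E‖) * Real.exp ‖H‖ +
      t⁻¹ * ‖S‖ * Real.exp ‖H‖ + t⁻¹ * ‖S‖ * Real.exp ‖D‖) atTop (𝓝 0) := by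
    have h0 : Tendsto (fun t : ℝ => t⁻¹) atTop (𝓝 0) := tendsto_inv_atTop_zero
    have := (((h0.mul_const ‖E‖).const_mul (Real.exp ‖D‖)).mul_const (Real.exp ‖H‖)).add
      ((h0.mul_const ‖S‖).mul_const (Real.exp ‖H‖)) |>.add
      ((h0.mul_const ‖S‖).mul_const (Real.exp ‖D‖))
    simpa using this
  refine squeeze_zero_norm' ?_ hlim
  filter_upwards [eventually_gt_atTop 0] with t ht
  have hA := bound H hH t ht.le
  have hB := bound D hD t ht.le
  have h := norm_mul_exp_sub_exp_mul_le (1 + t⁻¹ • S) _ _ hA hB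
  rw [key t ht, norm_smul, Real.norm_eq_abs, abs_of_pos (inv_pos.mpr ht)] at h
  set eA := NormedSpace.exp (H - t • Q)
  set eB := NormedSpace.exp (D - t • Q)
  have hA1 : ‖eA‖ ≤ Real.exp ‖H‖ := by simpa using hA 1 (by simp)
  have hB1 : ‖eB‖ ≤ Real.exp ‖D‖ := by simpa using hB 1 (by simp)
  have hSn : ‖t⁻¹ • S‖ = t⁻¹ * ‖S‖ := by
    rw [norm_smul, Real.norm_eq_abs, abs_of_pos (inv_pos.mpr ht)]
  have hdec : eA - eB = ((1 + t⁻¹ • S) * eA - eB * (1 + t⁻¹ • S)) - (t⁻¹ • S) * eA +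
      eB * (t⁻¹ • S) := by noncomm_ring
  rw [hdec]
  refine (norm_add_le _ _).trans (add_le_add ((norm_sub_le _ _).trans (add_le_add h ?_)) ?_)
  · refine (norm_mul_le _ _).trans ?_
    rw [hSn]; gcongr
  · refine (norm_mul_le _ _).trans ?_
    rw [hSn, mul_comm]; gcongr

/-- The trace formula for the derivative of the exponential: `τ (P (D exp)_a b) = τ (P e^a b)` for
a tracial functional `τ` and `P` commuting with `a`. -/
theorem tracial_fderiv_exp {𝔸 : Type*} [NormedRing 𝔸] [NormedAlgebra ℝ 𝔸]
    [CompleteSpace 𝔸] (τ : 𝔸 →L[ℝ] ℂ) (hτ : ∀ x y, τ (x * y) = τ (y * x)) {P a : 𝔸}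
    (hP : Commute P a) (b : 𝔸) :
    τ (P * fderiv ℝ (NormedSpace.exp : 𝔸 → 𝔸) a b) = τ (P * NormedSpace.exp a * b) := by
  let : NormedAlgebra ℚ 𝔸 := NormedAlgebra.restrictScalars ℚ ℝ 𝔸
  have hcd : ContDiff ℝ 1 (NormedSpace.exp : 𝔸 → 𝔸) :=
    contDiff_iff_contDiffAt.mpr fun x => (NormedSpace.exp_analytic (𝕂 := ℝ) x).contDiffAt
  have hdiff : Differentiable ℝ (NormedSpace.exp : 𝔸 → 𝔸) := hcd.differentiable (by simp)
  -- Product rule applied to `e^x = e^(x/2) e^(x/2)`.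
  have hhalf : ∀ x : 𝔸, fderiv ℝ (NormedSpace.exp : 𝔸 → 𝔸) x b = (1 / 2 : ℝ) •
      (fderiv ℝ (NormedSpace.exp : 𝔸 → 𝔸) ((1 / 2 : ℝ) • x) b *
          NormedSpace.exp ((1 / 2 : ℝ) • x) +
        NormedSpace.exp ((1 / 2 : ℝ) • x) *
          fderiv ℝ (NormedSpace.exp : 𝔸 → 𝔸) ((1 / 2 : ℝ) • x) b) := by
    intro x
    have h1 : (NormedSpace.exp : 𝔸 → 𝔸) = fun y => NormedSpace.exp ((1 / 2 : ℝ) • y) *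
        NormedSpace.exp ((1 / 2 : ℝ) • y) := by
      funext y
      have := NormedSpace.exp_add_of_commute (Commute.refl ((1 / 2 : ℝ) • y))
      rw [← this, ← add_smul]; norm_num
    have h2 : HasFDerivAt (fun y : 𝔸 => NormedSpace.exp ((1 / 2 : ℝ) • y)) _ x :=
      (hdiff ((1 / 2 : ℝ) • x)).hasFDerivAt.comp x ((hasFDerivAt_id x).const_smul (1 / 2 : ℝ))
    have h3 : HasFDerivAt (fun y : 𝔸 => NormedSpace.exp ((1 / 2 : ℝ) • y) *
        NormedSpace.exp ((1 / 2 : ℝ) • y)) _ x := h2.mul' h2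
    conv_lhs => rw [h1]
    rw [h3.fderiv]
    simp [smul_add, add_comm]
  -- Repeated halving: cyclicity of `τ` merges the two terms of the product rule, moving half of the
  -- remaining exponent out of the derivative. In the limit the derivative is taken at `0`, where it
  -- is the identity.
  have hstep : ∀ n : ℕ, τ (P * fderiv ℝ (NormedSpace.exp : 𝔸 → 𝔸) a b) =
      τ (P * NormedSpace.exp ((1 - (1 / 2 : ℝ) ^ n) • a) *
        fderiv ℝ (NormedSpace.exp : 𝔸 → 𝔸) ((1 / 2 : ℝ) ^ n • a) b) := by
    intro n
    induction n with
    | zero => simp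
    | succ n ih =>
      rw [ih, hhalf, smul_smul, ← pow_succ']
      set Y := fderiv ℝ (NormedSpace.exp : 𝔸 → 𝔸) ((1 / 2 : ℝ) ^ (n + 1) • a) b
      set e := NormedSpace.exp ((1 / 2 : ℝ) ^ (n + 1) • a) with he
      set E := NormedSpace.exp ((1 - (1 / 2 : ℝ) ^ n) • a) with hE
      have hEe : E * e = NormedSpace.exp ((1 - (1 / 2 : ℝ) ^ (n + 1)) • a) := by
        rw [hE, he, ← NormedSpace.exp_add_of_commute
          (((Commute.refl a).smul_left _).smul_right _), ← add_smul]
        congr 2; ring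
      have hec : Commute e (P * E) := by
        have h1 : Commute P e := (hP.smul_right _).exp_right
        have h2 : Commute E e := (((Commute.refl a).smul_left _).smul_right _).exp
        exact h1.symm.mul_right h2.symm
      have e1 : τ (P * E * (Y * e)) = τ (P * E * e * Y) := by
        rw [← mul_assoc, hτ, ← mul_assoc, hec.eq]
      rw [mul_smul_comm, map_smul, mul_add, map_add, e1, ← mul_assoc, mul_assoc P E e, hEe,
        ← two_smul ℝ, smul_smul]
      norm_num
  have hpow : Tendsto (fun n : ℕ => (1 / 2 : ℝ) ^ n) atTop (𝓝 0) :=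
    tendsto_pow_atTop_nhds_zero_of_lt_one (by norm_num) (by norm_num)
  have hlim : Tendsto (fun n : ℕ => τ (P * NormedSpace.exp ((1 - (1 / 2 : ℝ) ^ n) • a) *
        fderiv ℝ (NormedSpace.exp : 𝔸 → 𝔸) ((1 / 2 : ℝ) ^ n • a) b)) atTop
      (𝓝 (τ (P * NormedSpace.exp a * b))) := by
    have hc : Continuous fun r : ℝ => τ (P * NormedSpace.exp ((1 - r) • a) *
        fderiv ℝ (NormedSpace.exp : 𝔸 → 𝔸) (r • a) b) := by
      have h1 : Continuous (fderiv ℝ (NormedSpace.exp : 𝔸 → 𝔸)) :=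
        hcd.continuous_fderiv (by simp)
      have h2 : Continuous (NormedSpace.exp : 𝔸 → 𝔸) := hcd.continuous
      fun_prop
    have h0 := (hc.tendsto 0).comp hpow
    have hz : fderiv ℝ (NormedSpace.exp : 𝔸 → 𝔸) 0 = 1 := hasFDerivAt_exp_zero.fderiv
    simpa [Function.comp_def, hz] using h0
  refine tendsto_nhds_unique (Tendsto.congr (fun n => hstep n) tendsto_const_nhds) hlim

end ExponentialEstimates

/-! ### Gibbs states and their limit under penalization -/

section GibbsStates

open scoped Matrix.Norms.L2Operator MatrixOrder ComplexOrder

variable {ι κ : Type} [Fintype ι] [DecidableEq ι] [Fintype κ] [DecidableEq κ]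

/-- Exponentials respect intertwiners. -/
theorem exp_mul_eq_mul_exp {A : Matrix ι ι ℂ} {B : Matrix κ κ ℂ} {V : Matrix ι κ ℂ}
    (h : A * V = V * B) : NormedSpace.exp A * V = V * NormedSpace.exp B := by
  have hpow : ∀ n : ℕ, A ^ n * V = V * B ^ n := by
    intro n
    induction n with
    | zero => simp
    | succ n ih => rw [pow_succ', Matrix.mul_assoc, ih, ← Matrix.mul_assoc, h, Matrix.mul_assoc,
        ← pow_succ']
  have hA := NormedSpace.exp_series_hasSum_exp' (𝕂 := ℂ) A
  have hB := NormedSpace.exp_series_hasSum_exp' (𝕂 := ℂ) B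
  have h1 := hA.map (AddMonoidHom.mk' (fun X : Matrix ι ι ℂ => X * V)
    (fun X Y => Matrix.add_mul X Y V)) (continuous_id.matrix_mul continuous_const)
  have h2 := hB.map (AddMonoidHom.mk' (fun X : Matrix κ κ ℂ => V * X)
    (fun X Y => Matrix.mul_add V X Y)) (continuous_const.matrix_mul continuous_id)
  refine h1.unique ?_
  convert h2 using 1
  · funext n
    simp [hpow n]
  · rfl

/-- The factor `e^c` cancels in the normalization. This trades the growing term `t V Vᴴ` for the
penalty `-t (1 - V Vᴴ)`, whose exponential stays bounded. -/
theorem gibbs_add_smul_one (A : Matrix ι ι ℂ) (c : ℂ) : gibbs (A + c • 1) = gibbs A := by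
  have h : NormedSpace.exp (A + c • (1 : Matrix ι ι ℂ)) = Complex.exp c • NormedSpace.exp A := by
    rw [Matrix.exp_add_of_commute _ _ ((Commute.one_right A).smul_right c),
      ← Algebra.algebraMap_eq_smul_one, ← NormedSpace.algebraMap_exp_comm,
      ← Complex.exp_eq_exp_ℂ, Algebra.algebraMap_eq_smul_one, mul_smul_comm, mul_one]
  rw [gibbs, gibbs, h, Matrix.trace_smul, smul_smul, smul_eq_mul, mul_inv, mul_right_comm,
    inv_mul_cancel₀ (Complex.exp_ne_zero c), one_mul]

/-- The source of all positivity of Gibbs states; the factor is moreover invertible, so the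
partition function cannot vanish. -/
theorem exp_eq_conjTranspose_mul_self {A : Matrix ι ι ℂ} (hA : A.IsHermitian) :
    NormedSpace.exp A =
      (NormedSpace.exp ((1 / 2 : ℝ) • A))ᴴ * NormedSpace.exp ((1 / 2 : ℝ) • A) := by
  have h : ((1 / 2 : ℝ) • A).IsHermitian := by
    rw [Matrix.IsHermitian, Matrix.conjTranspose_smul, hA.eq]; simp
  rw [h.exp.eq, ← Matrix.exp_add_of_commute _ _ (Commute.refl _), ← add_smul]
  norm_num

theorem trace_exp_pos [Nonempty ι] {A : Matrix ι ι ℂ} (hA : A.IsHermitian) :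
    0 < (NormedSpace.exp A).trace := by
  rw [exp_eq_conjTranspose_mul_self hA]
  refine lt_of_le_of_ne (Matrix.posSemidef_conjTranspose_mul_self _).trace_nonneg fun h => ?_
  have h0 := Matrix.trace_conjTranspose_mul_self_eq_zero_iff.mp h.symm
  exact (Matrix.isUnit_exp ((1 / 2 : ℝ) • A)).ne_zero h0

theorem gibbs_posSemidef {A : Matrix ι ι ℂ} (hA : A.IsHermitian) : (gibbs A).PosSemidef := by
  have h : (NormedSpace.exp A).PosSemidef := by
    rw [exp_eq_conjTranspose_mul_self hA]; exact Matrix.posSemidef_conjTranspose_mul_self _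
  exact h.smul (inv_nonneg.mpr h.trace_nonneg)

theorem gibbs_trace [Nonempty ι] {A : Matrix ι ι ℂ} (hA : A.IsHermitian) :
    (gibbs A).trace = 1 := by
  rw [gibbs, Matrix.trace_smul, smul_eq_mul, inv_mul_cancel₀ (trace_exp_pos hA).ne']

/-- Under strong penalization of the complement of the range of an isometry `V`, the Gibbs state
of `H` becomes the Gibbs state of the compression `Vᴴ H V`. -/
theorem tendsto_gibbs_penalized [Nonempty κ] {H : Matrix ι ι ℂ} (hH : H.IsHermitian)
    {V : Matrix ι κ ℂ} (hV : Vᴴ * V = 1) :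
    Tendsto (fun t : ℝ => gibbs ((t : ℂ) • (V * Vᴴ) + H)) atTop
      (𝓝 (V * gibbs (Vᴴ * H * V) * Vᴴ)) := by
  set Q : Matrix ι ι ℂ := 1 - V * Vᴴ with hQ
  have hVV : V * Vᴴ * (V * Vᴴ) = V * Vᴴ := by
    rw [Matrix.mul_assoc, ← Matrix.mul_assoc Vᴴ, hV, Matrix.one_mul]
  have hQsa : IsSelfAdjoint Q := by
    rw [isSelfAdjoint_iff, Matrix.star_eq_conjTranspose, hQ]; simp
  have hQQ : Q * Q = Q := by
    rw [hQ, mul_sub, sub_mul _ _ (V * Vᴴ), hVV]; simp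
  have h1Q : 1 - Q = V * Vᴴ := by rw [hQ]; abel
  have hQV : Q * V = 0 := by rw [hQ, Matrix.sub_mul, Matrix.mul_assoc, hV]; simp
  set D : Matrix ι ι ℂ := (1 - Q) * H * (1 - Q) + Q * H * Q with hD
  have hDV : D * V = V * (Vᴴ * H * V) := by
    rw [hD, Matrix.add_mul, Matrix.mul_assoc (Q * H), hQV, h1Q]
    simp only [Matrix.mul_assoc, hV, Matrix.mul_one, Matrix.mul_zero, add_zero]
  have hDQ : Commute D Q := by
    have h0 : (1 - Q) * Q = 0 := by rw [sub_mul, hQQ, one_mul, sub_self]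
    have h0' : Q * (1 - Q) = 0 := by rw [mul_sub, hQQ, mul_one, sub_self]
    rw [commute_iff_eq, hD, add_mul, mul_add, mul_assoc _ (1 - Q) Q, h0, ← mul_assoc Q,
      ← mul_assoc Q, h0', mul_assoc _ Q Q, hQQ, ← mul_assoc, ← mul_assoc, hQQ]
    simp
  -- The exponential is computed separately on the range of `V`, where `Q` vanishes, and on the
  -- range of `Q`.
  have hexpQ : ∀ t : ℝ, NormedSpace.exp (-(t • Q)) = V * Vᴴ + Real.exp (-t) • Q := by
    intro t
    have e1 : NormedSpace.exp (-(t • Q)) * V = V := by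
      have : -(t • Q) * V = V * (0 : Matrix κ κ ℂ) := by
        rw [Matrix.neg_mul, Matrix.smul_mul, hQV]; simp
      have h := exp_mul_eq_mul_exp this
      simpa [NormedSpace.exp_zero] using h
    have e2 : NormedSpace.exp (-(t • Q)) * Q = Real.exp (-t) • Q := by
      have : -(t • Q) * Q = Q * (((-t : ℝ) : ℂ) • (1 : Matrix ι ι ℂ)) := by
        rw [neg_mul, smul_mul_assoc, hQQ, mul_smul_comm, mul_one, Complex.coe_smul, neg_smul]
      have h := exp_mul_eq_mul_exp this
      rw [h, ← Algebra.algebraMap_eq_smul_one, ← NormedSpace.algebraMap_exp_comm,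
        ← Complex.exp_eq_exp_ℂ, Algebra.algebraMap_eq_smul_one, mul_smul_comm, mul_one,
        ← Complex.ofReal_exp, Complex.coe_smul]
    calc NormedSpace.exp (-(t • Q)) = NormedSpace.exp (-(t • Q)) * V * Vᴴ +
          NormedSpace.exp (-(t • Q)) * Q := by
          rw [Matrix.mul_assoc, ← mul_add, ← h1Q]; simp
      _ = _ := by rw [e1, e2]
  have hlimD : Tendsto (fun t : ℝ => NormedSpace.exp (D - t • Q)) atTop
      (𝓝 (V * NormedSpace.exp (Vᴴ * H * V) * Vᴴ)) := by
    have h1 : ∀ t : ℝ, NormedSpace.exp (D - t • Q) =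
        V * NormedSpace.exp (Vᴴ * H * V) * Vᴴ + Real.exp (-t) • (NormedSpace.exp D * Q) := by
      intro t
      rw [sub_eq_add_neg, Matrix.exp_add_of_commute _ _ (hDQ.smul_right t).neg_right, hexpQ,
        mul_add, ← Matrix.mul_assoc, exp_mul_eq_mul_exp hDV, mul_smul_comm]
    simp only [h1]
    have h2 : Tendsto (fun t : ℝ => Real.exp (-t)) atTop (𝓝 0) :=
      Real.tendsto_exp_neg_atTop_nhds_zero
    simpa using (h2.smul_const (NormedSpace.exp D * Q)).const_add
      (V * NormedSpace.exp (Vᴴ * H * V) * Vᴴ)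
  have hlimH : Tendsto (fun t : ℝ => NormedSpace.exp (H - t • Q)) atTop
      (𝓝 (V * NormedSpace.exp (Vᴴ * H * V) * Vᴴ)) := by
    have := (tendsto_exp_penalized_sub (𝔸 := Matrix ι ι ℂ) hH hQsa hQQ).add hlimD
    simpa [hD] using this
  have htr : (V * NormedSpace.exp (Vᴴ * H * V) * Vᴴ).trace =
      (NormedSpace.exp (Vᴴ * H * V)).trace := by
    rw [Matrix.trace_mul_comm, ← Matrix.mul_assoc, hV, Matrix.one_mul]
  have hherm : (Vᴴ * H * V).IsHermitian := by
    have := Matrix.isHermitian_conjTranspose_mul_mul V hH; exact this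
  have hmain : Tendsto (fun t : ℝ => gibbs (H - t • Q)) atTop
      (𝓝 (V * gibbs (Vᴴ * H * V) * Vᴴ)) := by
    have h1 : Tendsto (fun t : ℝ => (NormedSpace.exp (H - t • Q)).trace⁻¹) atTop
        (𝓝 ((NormedSpace.exp (Vᴴ * H * V)).trace⁻¹)) := by
      rw [← htr]
      have hc : Continuous fun X : Matrix ι ι ℂ => X.trace := by fun_prop
      refine Tendsto.inv₀ ((hc.tendsto _).comp hlimH) ?_
      rw [htr]; exact (trace_exp_pos hherm).ne'
    have h2 := h1.smul hlimH
    rw [gibbs, Matrix.mul_smul, Matrix.smul_mul]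
    exact h2
  refine hmain.congr fun t => ?_
  rw [← gibbs_add_smul_one (H - t • Q) (t : ℂ), hQ]
  congr 1
  rw [← Complex.coe_smul, smul_sub]; abel

end GibbsStates

/-! ### The objective as an average over conditional Gibbs states -/

section Objective

variable {n h D K : ℕ}

/-- The isometry `|v⟩ ⊗ 1` from the hidden and label registers to all registers. -/
def inputIsometry (h : ℕ) (v : EuclideanSpace ℂ (Inp n)) :
    Matrix (Inp n × HidLab h) (HidLab h) ℂ :=
  Matrix.of fun p x => if p.2 = x then v p.1 else 0

/-- The projector `1 ⊗ |ℓ⟩⟨ℓ|` on the hidden and label registers. -/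
def condProj (h : ℕ) (l : EuclideanSpace ℂ (Fin 2)) : Matrix (HidLab h) (HidLab h) ℂ :=
  (1 : Matrix (Fin (2 ^ h)) (Fin (2 ^ h)) ℂ) ⊗ₖ ketbra l

theorem sum_star_mul_self_eq_one {ι : Type} [Fintype ι] {v : EuclideanSpace ℂ ι}
    (hv : ‖v‖ = 1) : ∑ a, star (v a) * v a = 1 := by
  have h := EuclideanSpace.norm_sq_eq v
  rw [hv] at h
  have h2 : ∑ a, star (v a) * v a = ((∑ a, ‖v a‖ ^ 2 : ℝ) : ℂ) := by
    push_cast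
    exact Finset.sum_congr rfl fun a _ => by
      rw [Complex.star_def, Complex.conj_mul']
  rw [h2, ← h]; norm_num

theorem inputIsometry_conjTranspose_mul_self {v : EuclideanSpace ℂ (Inp n)} (hv : ‖v‖ = 1) :
    (inputIsometry h v)ᴴ * inputIsometry h v = 1 := by
  ext x y
  rw [Matrix.mul_apply, Fintype.sum_prod_type]
  simp only [inputIsometry, Matrix.conjTranspose_apply, Matrix.of_apply, apply_ite star, star_zero,
    ite_mul, zero_mul, Finset.sum_ite_eq', Finset.mem_univ, if_true, mul_ite, mul_zero]
  by_cases hxy : x = y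
  · subst hxy
    simpa using sum_star_mul_self_eq_one hv
  · simp [hxy, Ne.symm hxy]

theorem inputIsometry_mul_conjTranspose (v : EuclideanSpace ℂ (Inp n)) :
    inputIsometry h v * (inputIsometry h v)ᴴ = ketbra v ⊗ₖ 1 := by
  ext ⟨a, x⟩ ⟨b, y⟩
  by_cases hxy : x = y
  · simp [Matrix.mul_apply, inputIsometry, ketbra, hxy]
  · simp [Matrix.mul_apply, inputIsometry, ketbra, hxy, Ne.symm hxy]

theorem conditional_eq (v : EuclideanSpace ℂ (Inp n)) (H : Op n h) :
    conditional v H = (inputIsometry h v)ᴴ * H * inputIsometry h v := by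
  ext x y
  simp only [conditional, Matrix.mul_apply, Fintype.sum_prod_type, inputIsometry, Matrix.of_apply,
    Matrix.conjTranspose_apply, apply_ite star, star_zero, ite_mul, zero_mul, mul_ite, mul_zero,
    Finset.sum_ite_eq', Finset.mem_univ, if_true, Finset.sum_mul]
  exact Finset.sum_comm

/-- The two operators act on different tensor factors. This transfers the label test, and its
commutation with the Harmony operators, to the compressed space. -/
theorem labelProj_mul_inputIsometry (v : EuclideanSpace ℂ (Inp n))
    (l : EuclideanSpace ℂ (Fin 2)) :
    labelProj n h l * inputIsometry h v = inputIsometry h v * condProj h l := by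
  ext ⟨a, x⟩ y
  simp [labelProj, condProj, inputIsometry, Matrix.mul_apply, Fintype.sum_prod_type,
    Matrix.one_apply, mul_comm]

theorem harmony_isHermitian {Hs : Fin D → Op n h} (hH : ∀ i, (Hs i).IsHermitian)
    (ω : Weights D) : (harmony Hs ω).IsHermitian := by
  rw [Matrix.IsHermitian, harmony, Matrix.conjTranspose_sum]
  refine Finset.sum_congr rfl fun i _ => ?_
  rw [Matrix.conjTranspose_smul, (hH i).eq]; simp

theorem conditional_isHermitian {H : Op n h} (hH : H.IsHermitian)
    (v : EuclideanSpace ℂ (Inp n)) : (conditional v H).IsHermitian := by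
  rw [conditional_eq]; exact Matrix.isHermitian_conjTranspose_mul_mul _ hH

theorem ketbra_isHermitian {ι : Type} (v : EuclideanSpace ℂ ι) : (ketbra v).IsHermitian := by
  ext i j; simp [ketbra, mul_comm]

theorem labelProj_isHermitian (l : EuclideanSpace ℂ (Fin 2)) :
    (labelProj n h l).IsHermitian := by
  rw [labelProj, Matrix.IsHermitian, Matrix.conjTranspose_kronecker,
    Matrix.conjTranspose_kronecker, (ketbra_isHermitian l).eq]
  simp

theorem commute_condProj_conditional {H : Op n h} {v : EuclideanSpace ℂ (Inp n)}
    {l : EuclideanSpace ℂ (Fin 2)} (hc : Commute (labelProj n h l) H) :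
    Commute (condProj h l) (conditional v H) := by
  have h1 := labelProj_mul_inputIsometry (h := h) v l
  have hP : (condProj h l).IsHermitian := by
    rw [condProj, Matrix.IsHermitian, Matrix.conjTranspose_kronecker, (ketbra_isHermitian l).eq]
    simp
  have h2 : (inputIsometry h v)ᴴ * labelProj n h l = condProj h l * (inputIsometry h v)ᴴ := by
    have := congrArg Matrix.conjTranspose h1
    rwa [Matrix.conjTranspose_mul, Matrix.conjTranspose_mul, hP.eq,
      (labelProj_isHermitian l).eq] at this
  rw [commute_iff_eq, conditional_eq, Matrix.mul_assoc _ _ (condProj h l), ← h1, ← Matrix.mul_assoc,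
    ← Matrix.mul_assoc, ← h2, Matrix.mul_assoc _ (labelProj n h l) H, hc.eq]
  simp only [Matrix.mul_assoc]

/-- The objective in terms of the conditional Gibbs states. -/
theorem objective_eq {Hs : Fin D → Op n h} (hH : ∀ i, (Hs i).IsHermitian)
    {v : Fin K → EuclideanSpace ℂ (Inp n)} (hv : ∀ k, ‖v k‖ = 1)
    (l : Fin K → EuclideanSpace ℂ (Fin 2)) :
    objective Hs v l = fun ω => (1 / (K : ℝ)) * ∑ k,
      ((condProj h (l k) * gibbsOracle Hs v k ω).trace).re := by
  funext ω
  refine Tendsto.limUnder_eq (Tendsto.const_mul _ (tendsto_finsetSum _ fun k _ => ?_))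
  have h1 := tendsto_gibbs_penalized (harmony_isHermitian hH ω)
    (inputIsometry_conjTranspose_mul_self (h := h) (hv k))
  rw [inputIsometry_mul_conjTranspose, ← conditional_eq] at h1
  have hc : Continuous fun X : Op n h => ((labelProj n h (l k) * X).trace).re := by fun_prop
  have h2 := (hc.tendsto _).comp h1
  have h3 : (labelProj n h (l k) * (inputIsometry h (v k) *
      gibbs (conditional (v k) (harmony Hs ω)) * (inputIsometry h (v k))ᴴ)).trace =
      (condProj h (l k) * gibbsOracle Hs v k ω).trace := by
    rw [gibbsOracle, ← Matrix.mul_assoc, ← Matrix.mul_assoc, labelProj_mul_inputIsometry,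
      Matrix.trace_mul_comm, ← Matrix.mul_assoc, ← Matrix.mul_assoc,
      inputIsometry_conjTranspose_mul_self (hv k), Matrix.one_mul]
  rw [h3] at h2
  exact h2

end Objective

/-! ### The gradient as a covariance -/

section Gradient

open scoped Matrix.Norms.L2Operator MatrixOrder ComplexOrder

variable {κ : Type} [Fintype κ] [DecidableEq κ] {n h D K : ℕ}

/-- The covariances of `P` with the operators `B i` in the state `ρ`. -/
def covariance (B : Fin D → Matrix κ κ ℂ) (P ρ : Matrix κ κ ℂ) : Weights D :=
  WithLp.toLp 2 fun i => ((B i * ρ * P).trace - (B i * ρ).trace * (ρ * P).trace).re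

/-- The matrix trace as a continuous real-linear functional. -/
def traceCLM (κ : Type) [Fintype κ] [DecidableEq κ] : Matrix κ κ ℂ →L[ℝ] ℂ :=
  (Matrix.traceLinearMap κ ℝ ℂ).toContinuousLinearMap

/-- The derivative of `ω ↦ Tr (P e^{M ω})` when `P` commutes with `M ω`. -/
theorem hasFDerivAt_trace_mul_exp (M : Weights D →L[ℝ] Matrix κ κ ℂ) {P : Matrix κ κ ℂ}
    {ω : Weights D} (hP : Commute P (M ω)) :
    HasFDerivAt (fun ω => (P * NormedSpace.exp (M ω)).trace)
      (traceCLM κ ∘L ContinuousLinearMap.mul ℝ (Matrix κ κ ℂ) (P * NormedSpace.exp (M ω)) ∘L M)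
      ω := by
  have hd : DifferentiableAt ℝ (NormedSpace.exp : Matrix κ κ ℂ → Matrix κ κ ℂ) (M ω) :=
    (NormedSpace.exp_analytic (𝕂 := ℝ) (M ω)).differentiableAt
  have h1 := (traceCLM κ ∘L ContinuousLinearMap.mul ℝ (Matrix κ κ ℂ) P).hasFDerivAt.comp ω
    (hd.hasFDerivAt.comp ω M.hasFDerivAt)
  refine HasFDerivAt.congr_fderiv (f := fun ω => (P * NormedSpace.exp (M ω)).trace) h1 ?_
  ext w
  exact tracial_fderiv_exp (traceCLM κ) (fun x y => Matrix.trace_mul_comm x y) hP (M w)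

/-- Quotient rule for `Tr(P e^M) / Tr e^M`, with `hasFDerivAt_trace_mul_exp` used for `P` and for
`1`. Without commutation the first derivative would involve an integral over imaginary-time
correlations instead of a single trace. -/
theorem hasGradientAt_gibbs_expectation [Nonempty κ] {B : Fin D → Matrix κ κ ℂ}
    (hB : ∀ i, (B i).IsHermitian) {P : Matrix κ κ ℂ} (hP : ∀ i, Commute P (B i))
    (ω : Weights D) :
    HasGradientAt (fun ω : Weights D => ((P * gibbs (∑ i, ((ω i : ℝ) : ℂ) • B i)).trace).re)
      (covariance B P (gibbs (∑ i, ((ω i : ℝ) : ℂ) • B i))) ω := by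
  set M : Weights D →L[ℝ] Matrix κ κ ℂ :=
    ∑ i, (EuclideanSpace.proj i : Weights D →L[ℝ] ℝ).smulRight (B i) with hM
  have hMω : ∀ ω : Weights D, M ω = ∑ i, ((ω i : ℝ) : ℂ) • B i := by
    intro ω
    simp [hM]
  simp only [← hMω]
  have hherm : (M ω).IsHermitian := by
    rw [hMω, Matrix.IsHermitian, Matrix.conjTranspose_sum]
    exact Finset.sum_congr rfl fun i _ => by rw [Matrix.conjTranspose_smul, (hB i).eq]; simp
  have hcomm : Commute P (M ω) := by
    rw [hMω]; exact Commute.sum_right _ _ _ fun i _ => (hP i).smul_right _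
  have hN := hasFDerivAt_trace_mul_exp M hcomm
  have hZ := hasFDerivAt_trace_mul_exp M (Commute.one_left (M ω))
  simp only [Matrix.one_mul] at hZ
  set e := NormedSpace.exp (M ω) with he
  have hZ0 : e.trace ≠ 0 := (trace_exp_pos hherm).ne'
  have hquot := Complex.reCLM.hasFDerivAt.comp ω
    (((hasFDerivAt_inv hZ0).restrictScalars ℝ).comp ω hZ |>.mul hN)
  rw [hasGradientAt_iff_hasFDerivAt]
  refine (HasFDerivAt.congr_fderiv hquot ?_).congr_of_eventuallyEq ?_
  · ext w
    have hw : (InnerProductSpace.toDual ℝ (Weights D)) (covariance B P (gibbs (M ω))) w =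
        ((M w * gibbs (M ω) * P).trace - (M w * gibbs (M ω)).trace *
          (gibbs (M ω) * P).trace).re := by
      rw [InnerProductSpace.toDual_apply_apply, PiLp.inner_apply, hMω w]
      simp only [Matrix.trace_sum, Finset.sum_mul, Matrix.smul_mul,
        Matrix.trace_smul, smul_eq_mul, ← Finset.sum_sub_distrib, Complex.re_sum, covariance]
      refine Finset.sum_congr rfl fun i _ => ?_
      rw [mul_assoc ((w i : ℝ) : ℂ), ← mul_sub, Complex.re_ofReal_mul]
      simp
    rw [hw]
    have hPe : Commute P e := hcomm.exp_right
    have t1 : (M w * e * P).trace = (P * e * M w).trace := by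
      rw [Matrix.trace_mul_comm (P * e), hPe.eq, Matrix.mul_assoc]
    have t2 : (M w * e).trace = (e * M w).trace := Matrix.trace_mul_comm _ _
    have t3 : (e * P).trace = (P * e).trace := Matrix.trace_mul_comm _ _
    simp only [gibbs, ← he, Matrix.mul_smul, Matrix.smul_mul, Matrix.trace_smul, smul_eq_mul, t1,
      t2, t3]
    change (e.trace⁻¹ * (P * e * M w).trace +
      (P * e).trace * ((e * M w).trace * (-(e.trace ^ 2)⁻¹))).re = _
    congr 1
    field_simp
    ring
  · filter_upwards with ω'
    simp [gibbs, Matrix.trace_smul]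

theorem conditional_harmony (Hs : Fin D → Op n h) (v : EuclideanSpace ℂ (Inp n))
    (ω : Weights D) :
    conditional v (harmony Hs ω) = ∑ i, ((ω i : ℝ) : ℂ) • conditional v (Hs i) := by
  simp only [conditional_eq, harmony, Matrix.mul_sum, Matrix.sum_mul, Matrix.mul_smul,
    Matrix.smul_mul]

/-- The gradient of the objective: the average of the conditional covariances of the label
projector with the Harmony operators. -/
def objectiveGradient (Hs : Fin D → Op n h) (v : Fin K → EuclideanSpace ℂ (Inp n))
    (l : Fin K → EuclideanSpace ℂ (Fin 2)) (ω : Weights D) : Weights D :=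
  (1 / (K : ℝ)) • ∑ k, covariance (fun i => conditional (v k) (Hs i)) (condProj h (l k))
    (gibbsOracle Hs v k ω)

theorem hasGradientAt_objective {Hs : Fin D → Op n h} (hH : ∀ i, (Hs i).IsHermitian)
    {v : Fin K → EuclideanSpace ℂ (Inp n)} (hv : ∀ k, ‖v k‖ = 1)
    {l : Fin K → EuclideanSpace ℂ (Fin 2)}
    (hc : ∀ k i, Commute (labelProj n h (l k)) (Hs i)) (ω : Weights D) :
    HasGradientAt (objective Hs v l) (objectiveGradient Hs v l ω) ω := by
  rw [objective_eq hH hv l]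
  have h1 : ∀ k, HasGradientAt (fun ω => ((condProj h (l k) * gibbsOracle Hs v k ω).trace).re)
      (covariance (fun i => conditional (v k) (Hs i)) (condProj h (l k))
        (gibbsOracle Hs v k ω)) ω := by
    intro k
    simp only [gibbsOracle, conditional_harmony]
    exact hasGradientAt_gibbs_expectation (fun i => conditional_isHermitian (hH i) (v k))
      (fun i => commute_condProj_conditional (hc k i)) ω
  have h2 := (HasFDerivAt.fun_sum (u := Finset.univ) fun k _ => (h1 k).hasFDerivAt).const_mul
    (1 / (K : ℝ))
  rw [hasGradientAt_iff_hasFDerivAt, objectiveGradient]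
  simpa using h2

end Gradient

/-! ### Reading both covariance terms from a unitary -/

section Registers

open scoped ComplexOrder

variable {n h : ℕ}

/-- Basis labels of two copies of the hidden and label registers, together with the training-data
register. -/
abbrev Reg (n h : ℕ) : Type := HidLab h × (HidLab h × ((Inp n × Fin 2) × Unit))

/-- The permutation of basis labels exchanging the two label qubits of the inner copy and of the
training-data register. -/
def labelSwap (n h : ℕ) : Equiv.Perm (Reg n h) where
  toFun w := (w.1, ((w.2.1.1, w.2.2.1.2), ((w.2.2.1.1, w.2.1.2), ())))
  invFun w := (w.1, ((w.2.1.1, w.2.2.1.2), ((w.2.2.1.1, w.2.1.2), ())))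
  left_inv _ := rfl
  right_inv _ := rfl

/-- The input register together with the inner (`true`) or the outer (`false`) copy of the hidden
and label registers, split off from the remaining registers. -/
def copyEquiv (n h : ℕ) : Bool → (Reg n h ≃ (Inp n × HidLab h) × (HidLab h × Fin 2))
  | true =>
    { toFun := fun w => ((w.2.2.1.1, w.2.1), (w.1, w.2.2.1.2))
      invFun := fun p => (p.2.1, (p.1.2, ((p.1.1, p.2.2), ())))
      left_inv := fun _ => rfl
      right_inv := fun _ => rfl }
  | false =>
    { toFun := fun w => ((w.2.2.1.1, w.1), (w.2.1, w.2.2.1.2))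
      invFun := fun p => (p.1.2, (p.2.1, ((p.1.1, p.2.2), ())))
      left_inv := fun _ => rfl
      right_inv := fun _ => rfl }

/-- The operator `H` applied to the input register and the chosen copy, followed by the label
swap. -/
def testOp (H : Op n h) (c : Bool) : Matrix (Reg n h) (Reg n h) ℂ :=
  (H ⊗ₖ (1 : Matrix (HidLab h × Fin 2) (HidLab h × Fin 2) ℂ)).submatrix
    ((labelSwap n h).trans (copyEquiv n h c)) (copyEquiv n h c)

theorem testOp_conjTranspose_mul_self {H : Op n h}
    (hH : H ∈ Matrix.unitaryGroup (Inp n × HidLab h) ℂ) (c : Bool) :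
    (testOp H c)ᴴ * testOp H c = 1 := by
  have hHH : Hᴴ * H = 1 := (Matrix.mem_unitaryGroup_iff').mp hH
  rw [testOp, Matrix.conjTranspose_submatrix, Matrix.submatrix_mul_equiv,
    Matrix.conjTranspose_kronecker, ← Matrix.mul_kronecker_mul, hHH]
  simp

/-- The training-data state `|v⟩|ℓ⟩`, as a density operator. -/
def dataState (v : EuclideanSpace ℂ (Inp n)) (l : EuclideanSpace ℂ (Fin 2)) :
    Matrix ((Inp n × Fin 2) × Unit) ((Inp n × Fin 2) × Unit) ℂ :=
  Matrix.of fun p q => v p.1.1 * l p.1.2 * star (v q.1.1 * l q.1.2)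

theorem dataState_posSemidef (v : EuclideanSpace ℂ (Inp n)) (l : EuclideanSpace ℂ (Fin 2)) :
    (dataState v l).PosSemidef := by
  have := Matrix.posSemidef_vecMulVec_self_star
    (fun p : (Inp n × Fin 2) × Unit => v p.1.1 * l p.1.2)
  exact this

theorem dataState_trace {v : EuclideanSpace ℂ (Inp n)} {l : EuclideanSpace ℂ (Fin 2)}
    (hv : ‖v‖ = 1) (hl : ‖l‖ = 1) : (dataState v l).trace = 1 := by
  have h1 := sum_star_mul_self_eq_one hv
  have h2 := sum_star_mul_self_eq_one hl
  calc (dataState v l).trace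
      = (∑ a, star (v a) * v a) * ∑ j, star (l j) * l j := by
        rw [Matrix.trace, Fintype.sum_prod_type, Fintype.sum_prod_type, Finset.sum_mul_sum]
        refine Finset.sum_congr rfl fun a _ => Finset.sum_congr rfl fun j _ => ?_
        simp only [dataState, Matrix.diag_apply, Matrix.of_apply, star_mul', Finset.univ_unique,
          Finset.sum_const, Finset.card_singleton, one_smul]
        ring
    _ = 1 := by rw [h1, h2, one_mul]

/-- The state on which a gradient coordinate is measured. -/
def testState (ρ : Matrix (HidLab h) (HidLab h) ℂ) (v : EuclideanSpace ℂ (Inp n))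
    (l : EuclideanSpace ℂ (Fin 2)) : Matrix (Reg n h) (Reg n h) ℂ :=
  ρ ⊗ₖ (ρ ⊗ₖ dataState v l)

theorem testState_trace {ρ : Matrix (HidLab h) (HidLab h) ℂ} (hρ : ρ.trace = 1)
    {v : EuclideanSpace ℂ (Inp n)} {l : EuclideanSpace ℂ (Fin 2)} (hv : ‖v‖ = 1)
    (hl : ‖l‖ = 1) : (testState ρ v l).trace = 1 := by
  rw [testState, Matrix.trace_kronecker, Matrix.trace_kronecker, hρ, dataState_trace hv hl]
  norm_num

/-- Swap trick: swapping a label qubit with one in state `|ℓ⟩` has the expectation of `|ℓ⟩⟨ℓ|`. Here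
`H` acts on the copy taking part in the swap, so the two operators multiply inside one trace; the
outer copy is idle. -/
theorem trace_testOp_mul_testState_true (H : Op n h) (ρ : Matrix (HidLab h) (HidLab h) ℂ)
    (v : EuclideanSpace ℂ (Inp n)) (l : EuclideanSpace ℂ (Fin 2)) :
    (testOp H true * testState ρ v l).trace =
      (conditional v H * ρ * condProj h l).trace * ρ.trace := by
  have h1 : (testOp H true * testState ρ v l).trace = ∑ y, ∑ x1, ∑ x2, ∑ a, ∑ j, ∑ x', ∑ a',
      H (a, (x1, j)) (a', x') * (ρ y y * (ρ x' (x1, x2) *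
        (v a' * l x2 * star (v a * l j)))) := by
    simp only [Matrix.trace, Matrix.diag_apply, Matrix.mul_apply]
    rw [Fintype.sum_prod_type]
    refine Finset.sum_congr rfl fun y _ => ?_
    rw [Fintype.sum_prod_type, Fintype.sum_prod_type]
    refine Finset.sum_congr rfl fun x1 _ => Finset.sum_congr rfl fun x2 _ => ?_
    rw [Fintype.sum_prod_type, Fintype.sum_prod_type]
    refine Finset.sum_congr rfl fun a _ => Finset.sum_congr rfl fun j _ => ?_
    rw [Fintype.sum_unique, Fintype.sum_prod_type, Finset.sum_eq_single y]
    · rw [Fintype.sum_prod_type]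
      refine Finset.sum_congr rfl fun x' _ => ?_
      rw [Fintype.sum_prod_type, Fintype.sum_prod_type]
      refine Finset.sum_congr rfl fun a' _ => ?_
      rw [Finset.sum_eq_single x2]
      · simp [testOp, testState, dataState, labelSwap, copyEquiv]
      · intro j' _ hj
        simp [testOp, testState, dataState, labelSwap, copyEquiv, Ne.symm hj]
      · simp
    · intro y' _ hy
      refine Finset.sum_eq_zero fun w _ => ?_
      simp [testOp, labelSwap, copyEquiv, Ne.symm hy]
    · simp
  have h2 : (conditional v H * ρ * condProj h l).trace = ∑ x1, ∑ j, ∑ x2, ∑ x', ∑ a, ∑ a',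
      H (a, (x1, j)) (a', x') * ρ x' (x1, x2) * (v a' * l x2 * star (v a * l j)) := by
    simp only [Matrix.trace, Matrix.diag_apply, Matrix.mul_apply (M := conditional v H * ρ)]
    rw [Fintype.sum_prod_type]
    refine Finset.sum_congr rfl fun x1 _ => Finset.sum_congr rfl fun j _ => ?_
    rw [Fintype.sum_prod_type, Finset.sum_eq_single x1]
    · refine Finset.sum_congr rfl fun x2 _ => ?_
      simp only [Matrix.mul_apply, Finset.sum_mul]
      refine Finset.sum_congr rfl fun x' _ => ?_
      simp only [conditional, Matrix.of_apply, Finset.sum_mul]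
      refine Finset.sum_congr rfl fun a _ => Finset.sum_congr rfl fun a' _ => ?_
      simp only [condProj, Matrix.kroneckerMap_apply, Matrix.one_apply_eq, ketbra, Matrix.of_apply,
        star_mul']
      ring
    · intro x1' _ hx
      refine Finset.sum_eq_zero fun x2 _ => ?_
      simp [condProj, hx]
    · simp
  rw [h1, h2, mul_comm, Matrix.trace, Finset.sum_mul]
  refine Finset.sum_congr rfl fun y _ => ?_
  rw [Finset.mul_sum]
  refine Finset.sum_congr rfl fun x1 _ => ?_
  rw [Finset.mul_sum]
  calc _ = ∑ x2, ∑ j, ∑ a, ∑ x', ∑ a',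
      H (a, (x1, j)) (a', x') * (ρ y y * (ρ x' (x1, x2) *
        (v a' * l x2 * star (v a * l j)))) := Finset.sum_congr rfl fun _ _ => Finset.sum_comm
    _ = _ := by
      rw [Finset.sum_comm]
      refine Finset.sum_congr rfl fun j _ => ?_
      rw [Finset.mul_sum]
      refine Finset.sum_congr rfl fun x2 _ => ?_
      rw [Finset.sum_comm, Finset.mul_sum]
      refine Finset.sum_congr rfl fun x' _ => ?_
      rw [Finset.mul_sum]
      refine Finset.sum_congr rfl fun a _ => ?_
      rw [Finset.mul_sum]
      refine Finset.sum_congr rfl fun a' _ => ?_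
      rw [Matrix.diag_apply]; ring

/-- The same swap, but `H` acts on the other copy of `ρ`, so the trace factorizes. -/
theorem trace_testOp_mul_testState_false (H : Op n h) (ρ : Matrix (HidLab h) (HidLab h) ℂ)
    (v : EuclideanSpace ℂ (Inp n)) (l : EuclideanSpace ℂ (Fin 2)) :
    (testOp H false * testState ρ v l).trace =
      (conditional v H * ρ).trace * (ρ * condProj h l).trace := by
  have h1 : (testOp H false * testState ρ v l).trace = ∑ y, ∑ x1, ∑ x2, ∑ a, ∑ j, ∑ y', ∑ a',
      H (a, y) (a', y') * (ρ y' y * (ρ (x1, j) (x1, x2) *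
        (v a' * l x2 * star (v a * l j)))) := by
    simp only [Matrix.trace, Matrix.diag_apply, Matrix.mul_apply]
    rw [Fintype.sum_prod_type]
    refine Finset.sum_congr rfl fun y _ => ?_
    rw [Fintype.sum_prod_type, Fintype.sum_prod_type]
    refine Finset.sum_congr rfl fun x1 _ => Finset.sum_congr rfl fun x2 _ => ?_
    rw [Fintype.sum_prod_type, Fintype.sum_prod_type]
    refine Finset.sum_congr rfl fun a _ => Finset.sum_congr rfl fun j _ => ?_
    rw [Fintype.sum_unique, Fintype.sum_prod_type]
    refine Finset.sum_congr rfl fun y' _ => ?_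
    rw [Fintype.sum_prod_type, Finset.sum_eq_single (x1, j)]
    · rw [Fintype.sum_prod_type, Fintype.sum_prod_type]
      refine Finset.sum_congr rfl fun a' _ => ?_
      rw [Finset.sum_eq_single x2]
      · simp [testOp, testState, dataState, labelSwap, copyEquiv]
      · intro j' _ hj
        simp [testOp, testState, dataState, labelSwap, copyEquiv, Ne.symm hj]
      · simp
    · intro x' _ hx
      refine Finset.sum_eq_zero fun w _ => ?_
      simp [testOp, labelSwap, copyEquiv, Ne.symm hx]
    · simp
  have h2 : (conditional v H * ρ).trace = ∑ y, ∑ y', ∑ a, ∑ a',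
      H (a, y) (a', y') * ρ y' y * (v a' * star (v a)) := by
    simp only [Matrix.trace, Matrix.diag_apply, Matrix.mul_apply]
    refine Finset.sum_congr rfl fun y _ => Finset.sum_congr rfl fun y' _ => ?_
    simp only [conditional, Matrix.of_apply, Finset.sum_mul]
    refine Finset.sum_congr rfl fun a _ => Finset.sum_congr rfl fun a' _ => ?_
    ring
  have h3 : (ρ * condProj h l).trace = ∑ x1, ∑ j, ∑ x2,
      ρ (x1, j) (x1, x2) * (l x2 * star (l j)) := by
    simp only [Matrix.trace, Matrix.diag_apply, Matrix.mul_apply]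
    rw [Fintype.sum_prod_type]
    refine Finset.sum_congr rfl fun x1 _ => Finset.sum_congr rfl fun j _ => ?_
    rw [Fintype.sum_prod_type, Finset.sum_eq_single x1]
    · simp [condProj, ketbra]
    · intro x1' _ hx
      refine Finset.sum_eq_zero fun x2 _ => ?_
      simp [condProj, hx]
    · simp
  rw [h1, h2, h3, Finset.sum_mul]
  refine Finset.sum_congr rfl fun y _ => ?_
  rw [Finset.mul_sum]
  refine Finset.sum_congr rfl fun x1 _ => ?_
  calc _ = ∑ x2, ∑ j, ∑ a, ∑ y', ∑ a',
      H (a, y) (a', y') * (ρ y' y * (ρ (x1, j) (x1, x2) *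
        (v a' * l x2 * star (v a * l j)))) := Finset.sum_congr rfl fun _ _ => Finset.sum_comm
    _ = _ := by
      rw [Finset.sum_comm, Finset.mul_sum]
      refine Finset.sum_congr rfl fun j _ => ?_
      rw [Finset.mul_sum]
      refine Finset.sum_congr rfl fun x2 _ => ?_
      rw [Finset.sum_comm, Finset.sum_mul]
      refine Finset.sum_congr rfl fun y' _ => ?_
      rw [Finset.sum_mul]
      refine Finset.sum_congr rfl fun a _ => ?_
      rw [Finset.sum_mul]
      refine Finset.sum_congr rfl fun a' _ => ?_
      rw [star_mul']; ring

end Registers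

/-! ### Unbiased gradient samples from Hadamard tests -/

section Sampling

open scoped ComplexOrder

variable {n h K D : ℕ}

namespace QueryAlgorithm

/-- Homogeneity lets branch weights be pulled out of unnormalized states and treated as classical
probabilities. -/
theorem prob_ofReal_smul (F : Fin K → Matrix (Inp n × Fin 2) (Inp n × Fin 2) ℂ)
    (G : Fin K → Weights D → Matrix (HidLab h) (HidLab h) ℂ) (E : Set (Weights D)) (r : ℝ)
    {W : Type} (alg : QueryAlgorithm n h K D W) (ρ : Matrix W W ℂ) :
    prob F G E alg ((r : ℂ) • ρ) = r * prob F G E alg ρ := by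
  induction alg with
  | output ω =>
    by_cases hω : ω ∈ E <;> simp [prob, hω]
  | instrument M hM next ih =>
    simp only [prob, Finset.mul_sum]
    refine Finset.sum_congr rfl fun x _ => ?_
    rw [Matrix.mul_smul, Matrix.smul_mul, ih]
  | queryF k inverse next ih =>
    simp only [prob]
    rw [Matrix.mul_smul, Matrix.smul_mul, ih]
  | queryG k ω next ih =>
    simp only [prob]
    rw [Matrix.kronecker_smul, ih]

theorem prob_nonneg (F : Fin K → Matrix (Inp n × Fin 2) (Inp n × Fin 2) ℂ)
    {G : Fin K → Weights D → Matrix (HidLab h) (HidLab h) ℂ} (hG : ∀ k ω, (G k ω).PosSemidef)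
    (E : Set (Weights D)) {W : Type} [Finite W] (alg : QueryAlgorithm n h K D W)
    {ρ : Matrix W W ℂ} (hρ : ρ.PosSemidef) : 0 ≤ prob F G E alg ρ := by
  revert ρ
  revert ‹Finite W›
  induction alg with
  | output ω =>
    intro _ ρ hρ
    exact Set.indicator_nonneg (fun _ _ => (Complex.le_def.mp hρ.trace_nonneg).1) _
  | instrument M hM next ih =>
    intro _ ρ hρ
    exact Finset.sum_nonneg fun x _ => ih x (hρ.mul_mul_conjTranspose_same (M x))
  | queryF k inverse next ih =>
    intro _ ρ hρ
    exact ih (hρ.mul_mul_conjTranspose_same _)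
  | queryG k ω next ih =>
    intro _ ρ hρ
    exact ih ((hG k ω).kronecker hρ)

/-- Performs a measurement on the workspace, discards the workspace, and continues according to
the outcome. -/
def measure {W X : Type} [Fintype W] [DecidableEq W] [Fintype X] (M : X → Matrix W W ℂ)
    (hM : ∑ x, (M x)ᴴ * M x = 1) (next : X → QueryAlgorithm n h K D Unit) :
    QueryAlgorithm n h K D W :=
  -- Discarding the workspace is done by measuring it in the basis `W` and ignoring the result.
  instrument (X := X × W) (fun p => (Matrix.of fun _ w => M p.1 p.2 w : Matrix Unit W ℂ))
    (by
      rw [← hM, Fintype.sum_prod_type]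
      refine Finset.sum_congr rfl fun x _ => ?_
      ext i j
      simp [Matrix.sum_apply, Matrix.mul_apply])
    (fun p => next p.1)

theorem prob_measure (F : Fin K → Matrix (Inp n × Fin 2) (Inp n × Fin 2) ℂ)
    (G : Fin K → Weights D → Matrix (HidLab h) (HidLab h) ℂ) (E : Set (Weights D))
    {W X : Type} [Fintype W] [DecidableEq W] [Fintype X] (M : X → Matrix W W ℂ)
    (hM : ∑ x, (M x)ᴴ * M x = 1) (next : X → QueryAlgorithm n h K D Unit) {ρ : Matrix W W ℂ}
    (hρ : ρ.PosSemidef) :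
    prob F G E (measure M hM next) ρ =
      ∑ x, (M x * ρ * (M x)ᴴ).trace.re * prob F G E (next x) 1 := by
  rw [measure, prob, Fintype.sum_prod_type]
  refine Finset.sum_congr rfl fun x _ => ?_
  rw [Matrix.trace, Complex.re_sum, Finset.sum_mul]
  refine Finset.sum_congr rfl fun w _ => ?_
  have h0 : 0 ≤ (M x * ρ * (M x)ᴴ) w w := (hρ.mul_mul_conjTranspose_same (M x)).diag_nonneg
  have h1 : (Matrix.of fun _ w' => M x w w' : Matrix Unit W ℂ) * ρ *
      (Matrix.of fun _ w' => M x w w' : Matrix Unit W ℂ)ᴴ =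
      (((M x * ρ * (M x)ᴴ) w w).re : ℂ) • 1 := by
    rw [← Complex.eq_re_of_ofReal_le h0]
    ext i j
    simp [Matrix.mul_apply]
  rw [h1, prob_ofReal_smul]
  rfl

end QueryAlgorithm

/-- The sign `±1` of a bit. -/
def bitSign (b : Bool) : ℝ := if b then 1 else -1

/-- The Kraus operators `(1 ± U) / 2` of the Hadamard test. -/
def hadamardTest {W : Type} [DecidableEq W] (U : Matrix W W ℂ) (b : Bool) : Matrix W W ℂ :=
  ((1 / 2 : ℝ) : ℂ) • (1 + (bitSign b : ℂ) • U)

theorem hadamardTest_sum {W : Type} [Fintype W] [DecidableEq W] {U : Matrix W W ℂ}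
    (hU : Uᴴ * U = 1) : ∑ b, (hadamardTest U b)ᴴ * hadamardTest U b = 1 := by
  simp only [Fintype.sum_bool, hadamardTest, bitSign, if_true, Bool.false_eq_true, if_false,
    Matrix.conjTranspose_smul, Matrix.smul_mul, Matrix.mul_smul, Matrix.conjTranspose_add,
    Matrix.conjTranspose_one, add_mul, mul_add, hU, mul_one, one_mul, smul_smul]
  ext i j
  simp
  ring

/-- The expected sign in the Hadamard test is `Re Tr (U ρ)`. -/
theorem hadamardTest_expectation {W : Type} [Fintype W] [DecidableEq W] (U : Matrix W W ℂ)
    {ρ : Matrix W W ℂ} (hρ : ρ.IsHermitian) :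
    ∑ b, bitSign b * (hadamardTest U b * ρ * (hadamardTest U b)ᴴ).trace.re =
      (U * ρ).trace.re := by
  have h1 : (ρ * Uᴴ).trace.re = (U * ρ).trace.re := by
    have h : (ρ * Uᴴ).trace = star (U * ρ).trace := by
      rw [← Matrix.trace_conjTranspose, Matrix.conjTranspose_mul, hρ.eq]
    rw [h]; simp
  simp only [Fintype.sum_bool, hadamardTest, bitSign, if_true, Bool.false_eq_true, if_false,
    Matrix.conjTranspose_smul, Matrix.smul_mul, Matrix.mul_smul, Matrix.conjTranspose_add,
    Matrix.conjTranspose_one, add_mul, mul_add, mul_one, one_mul, smul_smul,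
    Matrix.trace_smul, Matrix.trace_add, smul_eq_mul]
  simp [h1]
  ring

theorem hadamardTest_trace_sum {W : Type} [Fintype W] [DecidableEq W] {U : Matrix W W ℂ}
    (hU : Uᴴ * U = 1) (ρ : Matrix W W ℂ) :
    ∑ b, (hadamardTest U b * ρ * (hadamardTest U b)ᴴ).trace.re = ρ.trace.re := by
  have : ∀ b, (hadamardTest U b * ρ * (hadamardTest U b)ᴴ).trace =
      ((hadamardTest U b)ᴴ * hadamardTest U b * ρ).trace := fun b => by
    rw [Matrix.trace_mul_comm, Matrix.mul_assoc]
  simp only [this]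
  rw [← Complex.re_sum, ← Matrix.trace_sum, ← Matrix.sum_mul, hadamardTest_sum hU, Matrix.one_mul]

/-- The choices made by coin flips in a single gradient sample: a training vector, a coordinate,
and one of the two terms of the covariance. -/
abbrev Coin (K D : ℕ) : Type := Fin K × Fin D × Bool

/-- The sample of the gradient for the coin `o` and the measurement outcome `b`. -/
def sampleValue (o : Coin K D) (b : Bool) : Weights D :=
  -- The factor `2D` undoes the probabilities `1/D` of the coordinate and `1/2` of the term; the
  -- probability `1/K` of the training vector is the average already present in the objective.
  (2 * D * bitSign o.2.2 * bitSign b) • EuclideanSpace.single o.2.1 1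

/-- Flips the coins and prepares the training-data register in the state `|0⟩`. -/
def coinKraus (n K D : ℕ) (_ : Coin K D) : Matrix ((Inp n × Fin 2) × Unit) Unit ℂ :=
  Matrix.of fun p _ => ((Real.sqrt (2 * K * D))⁻¹ : ℝ) *
    (Pi.single (0, 0) 1 : Inp n × Fin 2 → ℂ) p.1

theorem coinKraus_sum (n : ℕ) (hK : 0 < K) (hD : 0 < D) :
    ∑ o : Coin K D, (coinKraus n K D o)ᴴ * coinKraus n K D o = 1 := by
  have hpos : (0 : ℝ) < 2 * K * D := by positivity
  have h1 : ∀ o : Coin K D, (coinKraus n K D o)ᴴ * coinKraus n K D o =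
      ((2 * K * D : ℝ)⁻¹ : ℂ) • 1 := by
    intro o
    ext i j
    rw [Matrix.mul_apply, Fintype.sum_prod_type, Finset.sum_eq_single (0, 0)]
    · have : ((Real.sqrt (2 * K * D))⁻¹ : ℝ) * (Real.sqrt (2 * K * D))⁻¹ = (2 * K * D : ℝ)⁻¹ := by
        rw [← mul_inv, Real.mul_self_sqrt hpos.le]
      have hc := congrArg (fun x : ℝ => (x : ℂ)) this
      simp only [Complex.ofReal_mul] at hc
      simpa [coinKraus] using hc
    · intro p _ hp
      simp [coinKraus, hp]
    · simp
  simp only [h1, Finset.sum_const, Finset.card_univ, Fintype.card_prod, Fintype.card_fin,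
    Fintype.card_bool]
  have hK' : (K : ℂ) ≠ 0 := by exact_mod_cast hK.ne'
  have hD' : (D : ℂ) ≠ 0 := by exact_mod_cast hD.ne'
  ext i j
  simp
  field_simp

/-- Draws a single unbiased sample of the gradient of the objective at `ω`, with three queries. -/
def sample (hK : 0 < K) (hD : 0 < D) {Hs : Fin D → Op n h}
    (hU : ∀ i, Hs i ∈ Matrix.unitaryGroup (Inp n × HidLab h) ℂ) (ω : Weights D)
    (next : Weights D → QueryAlgorithm n h K D Unit) : QueryAlgorithm n h K D Unit :=
  .instrument (coinKraus n K D) (coinKraus_sum n hK hD) fun o =>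
    .queryF o.1 false (.queryG o.1 ω (.queryG o.1 ω
      (.measure (hadamardTest (testOp (Hs o.2.1) o.2.2))
        (hadamardTest_sum (testOp_conjTranspose_mul_self (hU o.2.1) o.2.2))
        fun b => next (sampleValue o b))))

theorem queries_sample_le (hK : 0 < K) (hD : 0 < D) {Hs : Fin D → Op n h}
    (hU : ∀ i, Hs i ∈ Matrix.unitaryGroup (Inp n × HidLab h) ℂ) (ω : Weights D)
    {next : Weights D → QueryAlgorithm n h K D Unit} {q : ℕ} (hq : ∀ z, (next z).queries ≤ q) :
    (sample hK hD hU ω next).queries ≤ q + 3 := by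
  simp only [sample, QueryAlgorithm.queries, QueryAlgorithm.measure]
  refine Finset.sup_le fun o _ => ?_
  exact Nat.add_le_add_right (Finset.sup_le fun p _ => hq _) 3

/-- The probability of a coin together with a measurement outcome. -/
def sampleWeight (Hs : Fin D → Op n h) (v : Fin K → EuclideanSpace ℂ (Inp n))
    (l : Fin K → EuclideanSpace ℂ (Fin 2)) (ω : Weights D) (p : Coin K D × Bool) : ℝ :=
  (2 * K * D : ℝ)⁻¹ * (hadamardTest (testOp (Hs p.1.2.1) p.1.2.2) p.2 *
    testState (gibbsOracle Hs v p.1.1 ω) (v p.1.1) (l p.1.1) *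
    (hadamardTest (testOp (Hs p.1.2.1) p.1.2.2) p.2)ᴴ).trace.re

theorem gibbsOracle_posSemidef {Hs : Fin D → Op n h} (hH : ∀ i, (Hs i).IsHermitian)
    (v : Fin K → EuclideanSpace ℂ (Inp n)) (k : Fin K) (ω : Weights D) :
    (gibbsOracle Hs v k ω).PosSemidef :=
  gibbs_posSemidef (conditional_isHermitian (harmony_isHermitian hH ω) (v k))

theorem testState_posSemidef {ρ : Matrix (HidLab h) (HidLab h) ℂ} (hρ : ρ.PosSemidef)
    (v : EuclideanSpace ℂ (Inp n)) (l : EuclideanSpace ℂ (Fin 2)) :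
    (testState ρ v l).PosSemidef :=
  hρ.kronecker (hρ.kronecker (dataState_posSemidef v l))

/-- After the queries, the branch of each coin holds `testState` scaled by `1/(2KD)`, and the
measurement leaves no quantum memory. From here on the algorithm is a classical random process. -/
theorem prob_sample (hK : 0 < K) (hD : 0 < D) {Hs : Fin D → Op n h}
    (hH : ∀ i, (Hs i).IsHermitian)
    (hU : ∀ i, Hs i ∈ Matrix.unitaryGroup (Inp n × HidLab h) ℂ)
    {v : Fin K → EuclideanSpace ℂ (Inp n)} {l : Fin K → EuclideanSpace ℂ (Fin 2)}
    {F : Fin K → Matrix (Inp n × Fin 2) (Inp n × Fin 2) ℂ} (hF : IsDataOracle v l F)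
    (E : Set (Weights D)) (ω : Weights D) (next : Weights D → QueryAlgorithm n h K D Unit) :
    (sample hK hD hU ω next).prob F (gibbsOracle Hs v) E 1 =
      ∑ p : Coin K D × Bool, sampleWeight Hs v l ω p *
        (next (sampleValue p.1 p.2)).prob F (gibbsOracle Hs v) E 1 := by
  have hpos : (0 : ℝ) < 2 * K * D := by positivity
  have hstate : ∀ o : Coin K D,
      (F o.1 ⊗ₖ (1 : Matrix Unit Unit ℂ)) *
        (coinKraus n K D o * (1 : Matrix Unit Unit ℂ) * (coinKraus n K D o)ᴴ) *
        (F o.1 ⊗ₖ (1 : Matrix Unit Unit ℂ))ᴴ =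
      (((2 * K * D : ℝ)⁻¹ : ℝ) : ℂ) • dataState (v o.1) (l o.1) := by
    intro o
    have h1 : ∀ p u, ((F o.1 ⊗ₖ (1 : Matrix Unit Unit ℂ)) * coinKraus n K D o) p u =
        ((Real.sqrt (2 * K * D))⁻¹ : ℝ) * (v o.1 p.1.1 * l o.1 p.1.2) := by
      intro p u
      have h2 := congrFun (hF o.1).2 p.1
      rw [← h2, Matrix.mul_apply, Fintype.sum_prod_type, Matrix.mulVec, dotProduct, Finset.mul_sum]
      refine Finset.sum_congr rfl fun q _ => ?_
      simp [coinKraus]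
      ring
    have h3 : (F o.1 ⊗ₖ (1 : Matrix Unit Unit ℂ)) *
        (coinKraus n K D o * (1 : Matrix Unit Unit ℂ) * (coinKraus n K D o)ᴴ) *
        (F o.1 ⊗ₖ (1 : Matrix Unit Unit ℂ))ᴴ =
        ((F o.1 ⊗ₖ (1 : Matrix Unit Unit ℂ)) * coinKraus n K D o) *
        ((F o.1 ⊗ₖ (1 : Matrix Unit Unit ℂ)) * coinKraus n K D o)ᴴ := by
      rw [Matrix.conjTranspose_mul, Matrix.mul_one]
      simp only [Matrix.mul_assoc]
    have h4 : ((Real.sqrt (2 * K * D))⁻¹ : ℝ) * (Real.sqrt (2 * K * D))⁻¹ =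
        (2 * K * D : ℝ)⁻¹ := by
      rw [← mul_inv, Real.mul_self_sqrt hpos.le]
    rw [h3, ← h4]
    ext p q
    rw [Matrix.mul_apply, Fintype.sum_unique, Matrix.conjTranspose_apply, h1, h1,
      Matrix.smul_apply, dataState, Matrix.of_apply, star_mul', smul_eq_mul, Complex.star_def,
      Complex.conj_ofReal, Complex.ofReal_mul]
    ring
  rw [Fintype.sum_prod_type, sample, QueryAlgorithm.prob]
  refine Finset.sum_congr rfl fun o _ => ?_
  simp only [QueryAlgorithm.prob, Bool.false_eq_true, if_false]
  rw [hstate o, Matrix.kronecker_smul, Matrix.kronecker_smul, QueryAlgorithm.prob_ofReal_smul,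
    ← testState, QueryAlgorithm.prob_measure _ _ _ _ _ _ (testState_posSemidef
      (gibbsOracle_posSemidef hH v o.1 ω) (v o.1) (l o.1)), Finset.mul_sum]
  refine Finset.sum_congr rfl fun b _ => ?_
  rw [← mul_assoc]
  rfl

theorem sampleWeight_nonneg {Hs : Fin D → Op n h} (hH : ∀ i, (Hs i).IsHermitian)
    (v : Fin K → EuclideanSpace ℂ (Inp n)) (l : Fin K → EuclideanSpace ℂ (Fin 2))
    (ω : Weights D) (p : Coin K D × Bool) : 0 ≤ sampleWeight Hs v l ω p :=
  mul_nonneg (by positivity) (Complex.le_def.mp ((testState_posSemidef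
    (gibbsOracle_posSemidef hH v p.1.1 ω) (v p.1.1) (l p.1.1)).mul_mul_conjTranspose_same
      _).trace_nonneg).1

theorem sampleWeight_sum (hK : 0 < K) (hD : 0 < D) {Hs : Fin D → Op n h}
    (hH : ∀ i, (Hs i).IsHermitian)
    (hU : ∀ i, Hs i ∈ Matrix.unitaryGroup (Inp n × HidLab h) ℂ)
    {v : Fin K → EuclideanSpace ℂ (Inp n)} (hv : ∀ k, ‖v k‖ = 1)
    {l : Fin K → EuclideanSpace ℂ (Fin 2)} (hl : ∀ k, ‖l k‖ = 1) (ω : Weights D) :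
    ∑ p, sampleWeight Hs v l ω p = 1 := by
  rw [Fintype.sum_prod_type]
  have h1 : ∀ o : Coin K D, ∑ b, sampleWeight Hs v l ω (o, b) = (2 * K * D : ℝ)⁻¹ := by
    intro o
    have hρ : (gibbsOracle Hs v o.1 ω).trace = 1 :=
      gibbs_trace (conditional_isHermitian (harmony_isHermitian hH ω) (v o.1))
    simp only [sampleWeight]
    rw [← Finset.mul_sum, hadamardTest_trace_sum (testOp_conjTranspose_mul_self (hU o.2.1) _),
      testState_trace hρ (hv o.1) (hl o.1)]
    simp
  simp only [h1, Finset.sum_const, Finset.card_univ, Fintype.card_prod, Fintype.card_fin,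
    Fintype.card_bool, nsmul_eq_mul]
  push_cast
  field_simp

theorem norm_sampleValue (o : Coin K D) (b : Bool) : ‖sampleValue o b‖ = 2 * D := by
  have h : ∀ c, |bitSign c| = 1 := by intro c; cases c <;> simp [bitSign]
  simp [sampleValue, norm_smul, h]

/-- The samples are unbiased. -/
theorem sampleWeight_expectation (hD : 0 < D) {Hs : Fin D → Op n h}
    (hH : ∀ i, (Hs i).IsHermitian)
    {v : Fin K → EuclideanSpace ℂ (Inp n)} (l : Fin K → EuclideanSpace ℂ (Fin 2))
    (ω : Weights D) :
    ∑ p, sampleWeight Hs v l ω p • sampleValue p.1 p.2 = objectiveGradient Hs v l ω := by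
  have hD' : (D : ℝ) ≠ 0 := by positivity
  have h1 : ∀ o : Coin K D, ∑ b, sampleWeight Hs v l ω (o, b) • sampleValue o b =
      ((K : ℝ)⁻¹ * (bitSign o.2.2 * (testOp (Hs o.2.1) o.2.2 *
        testState (gibbsOracle Hs v o.1 ω) (v o.1) (l o.1)).trace.re)) •
        EuclideanSpace.single o.2.1 (1 : ℝ) := by
    intro o
    rw [← hadamardTest_expectation _ (testState_posSemidef
      (gibbsOracle_posSemidef hH v o.1 ω) (v o.1) (l o.1)).isHermitian]
    simp only [sampleWeight, sampleValue, smul_smul, ← Finset.sum_smul, Finset.mul_sum]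
    congr 1
    refine Finset.sum_congr rfl fun b _ => ?_
    rw [mul_inv, mul_inv]
    field_simp
  have hρ : ∀ k, (gibbsOracle Hs v k ω).trace = 1 := fun k =>
    gibbs_trace (conditional_isHermitian (harmony_isHermitian hH ω) (v k))
  rw [Fintype.sum_prod_type]
  simp only [h1]
  rw [Fintype.sum_prod_type, objectiveGradient, Finset.smul_sum]
  refine Finset.sum_congr rfl fun k _ => ?_
  rw [Fintype.sum_prod_type]
  ext i
  simp only [Fintype.sum_bool, bitSign, if_true, Bool.false_eq_true, if_false,
    trace_testOp_mul_testState_true, trace_testOp_mul_testState_false, hρ, mul_one]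
  simp [covariance, Finset.sum_add_distrib, Pi.single_apply]
  ring

end Sampling

/-! ### Concentration of sums of samples -/

section Batches

open scoped ComplexOrder

variable {n h K D : ℕ}

/-- Bias-variance decomposition: the variance is `σ² - ‖g‖²`, and the negative term is dropped. -/
theorem sum_weight_mul_norm_add_sq_le {E O : Type*} [NormedAddCommGroup E]
    [InnerProductSpace ℝ E] [Fintype O] {w : O → ℝ} (hw1 : ∑ o, w o = 1)
    {x : O → E} {g : E} (hg : ∑ o, w o • x o = g) {σ : ℝ} (hx : ∀ o, ‖x o‖ = σ) (u : E) :
    ∑ o, w o * ‖u + x o‖ ^ 2 ≤ ‖u + g‖ ^ 2 + σ ^ 2 := by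
  have h1 : ∑ o, w o * ‖u + x o‖ ^ 2 = ‖u‖ ^ 2 + 2 * inner ℝ u g + σ ^ 2 := by
    have : ∀ o, w o * ‖u + x o‖ ^ 2 =
        w o * (‖u‖ ^ 2 + σ ^ 2) + 2 * inner ℝ u (w o • x o) := by
      intro o
      rw [norm_add_sq_real, inner_smul_right, hx]; ring
    simp only [this]
    rw [Finset.sum_add_distrib, ← Finset.sum_mul, hw1, ← Finset.mul_sum, ← inner_sum, hg]
    ring
  rw [h1, norm_add_sq_real]
  nlinarith [sq_nonneg ‖g‖]

/-- Adds `m` independent gradient samples at `ω` to `z` and continues with the result. -/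
def batch (hK : 0 < K) (hD : 0 < D) {Hs : Fin D → Op n h}
    (hU : ∀ i, Hs i ∈ Matrix.unitaryGroup (Inp n × HidLab h) ℂ) (ω : Weights D)
    (next : Weights D → QueryAlgorithm n h K D Unit) :
    ℕ → Weights D → QueryAlgorithm n h K D Unit
  | 0, z => next z
  | m + 1, z => sample hK hD hU ω fun x => batch hK hD hU ω next m (z + x)

theorem queries_batch_le (hK : 0 < K) (hD : 0 < D) {Hs : Fin D → Op n h}
    (hU : ∀ i, Hs i ∈ Matrix.unitaryGroup (Inp n × HidLab h) ℂ) (ω : Weights D)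
    {next : Weights D → QueryAlgorithm n h K D Unit} {q : ℕ} (hq : ∀ z, (next z).queries ≤ q)
    (m : ℕ) (z : Weights D) : (batch hK hD hU ω next m z).queries ≤ q + 3 * m := by
  induction m generalizing z with
  | zero => exact hq z
  | succ m ih =>
    have := queries_sample_le hK hD hU ω (next := fun x => batch hK hD hU ω next m (z + x))
      fun x => ih (z + x)
    rw [batch]; omega

/-- The sum of `m` samples concentrates around `m` times the gradient. -/
theorem prob_batch_ge (hK : 0 < K) (hD : 0 < D) {Hs : Fin D → Op n h}
    (hH : ∀ i, (Hs i).IsHermitian)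
    (hU : ∀ i, Hs i ∈ Matrix.unitaryGroup (Inp n × HidLab h) ℂ)
    {v : Fin K → EuclideanSpace ℂ (Inp n)} (hv : ∀ k, ‖v k‖ = 1)
    {l : Fin K → EuclideanSpace ℂ (Fin 2)} (hl : ∀ k, ‖l k‖ = 1)
    {F : Fin K → Matrix (Inp n × Fin 2) (Inp n × Fin 2) ℂ} (hF : IsDataOracle v l F)
    (E : Set (Weights D)) (ω : Weights D) (next : Weights D → QueryAlgorithm n h K D Unit)
    {a b : ℝ} (hb : 0 ≤ b) {c : Weights D}
    (hnext : ∀ z, a - b * ‖z - c‖ ^ 2 ≤ (next z).prob F (gibbsOracle Hs v) E 1)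
    (m : ℕ) (z : Weights D) :
    a - b * (‖z + (m : ℝ) • objectiveGradient Hs v l ω - c‖ ^ 2 + m * (2 * D) ^ 2) ≤
      (batch hK hD hU ω next m z).prob F (gibbsOracle Hs v) E 1 := by
  -- Backward induction on a quadratic lower bound for the success probability: averaging over one
  -- sample shifts the centre by the gradient and costs at most `b (2D)²`.
  induction m generalizing z with
  | zero => simpa [batch] using hnext z
  | succ m ih =>
    rw [batch, prob_sample hK hD hH hU hF]
    set g := objectiveGradient Hs v l ω with hg
    have hw := sampleWeight_nonneg (K := K) hH v l ω
    have hw1 := sampleWeight_sum hK hD hH hU hv hl ω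
    have hvar := sum_weight_mul_norm_add_sq_le hw1
      (sampleWeight_expectation hD hH l ω) (fun p => norm_sampleValue p.1 p.2)
      (z + (m : ℝ) • g - c)
    have hrw : z + (m : ℝ) • g - c + g = z + ((m + 1 : ℕ) : ℝ) • g - c := by
      push_cast; rw [add_smul, one_smul]; abel
    rw [← hg, hrw] at hvar
    have hlow : ∑ p, sampleWeight Hs v l ω p *
        (a - b * (‖z + sampleValue p.1 p.2 + (m : ℝ) • g - c‖ ^ 2 + m * (2 * D) ^ 2)) ≤
        ∑ p, sampleWeight Hs v l ω p * (batch hK hD hU ω next m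
          (z + sampleValue p.1 p.2)).prob F (gibbsOracle Hs v) E 1 :=
      Finset.sum_le_sum fun p _ => mul_le_mul_of_nonneg_left (ih _) (hw p)
    refine le_trans ?_ hlow
    have hsum : ∑ p, sampleWeight Hs v l ω p *
        (a - b * (‖z + sampleValue p.1 p.2 + (m : ℝ) • g - c‖ ^ 2 + m * (2 * D) ^ 2)) =
        (a - b * (m * (2 * D) ^ 2)) - b * ∑ p, sampleWeight Hs v l ω p *
          ‖z + (m : ℝ) • g - c + sampleValue p.1 p.2‖ ^ 2 := by
      have : ∀ p : Coin K D × Bool, sampleWeight Hs v l ω p *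
          (a - b * (‖z + sampleValue p.1 p.2 + (m : ℝ) • g - c‖ ^ 2 + m * (2 * D) ^ 2)) =
          sampleWeight Hs v l ω p * (a - b * (m * (2 * D) ^ 2)) -
          b * (sampleWeight Hs v l ω p *
            ‖z + (m : ℝ) • g - c + sampleValue p.1 p.2‖ ^ 2) := by
        intro p
        rw [show z + sampleValue p.1 p.2 + (m : ℝ) • g - c =
          z + (m : ℝ) • g - c + sampleValue p.1 p.2 by abel]
        ring
      simp only [this]
      rw [Finset.sum_sub_distrib, ← Finset.sum_mul, hw1, one_mul, ← Finset.mul_sum]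
    rw [hsum]
    have := mul_le_mul_of_nonneg_left hvar hb
    push_cast at this ⊢
    linarith

/-- The gradient is a mean of vectors of norm `2D`. -/
theorem norm_objectiveGradient_le (hK : 0 < K) (hD : 0 < D) {Hs : Fin D → Op n h}
    (hH : ∀ i, (Hs i).IsHermitian)
    (hU : ∀ i, Hs i ∈ Matrix.unitaryGroup (Inp n × HidLab h) ℂ)
    {v : Fin K → EuclideanSpace ℂ (Inp n)} (hv : ∀ k, ‖v k‖ = 1)
    {l : Fin K → EuclideanSpace ℂ (Fin 2)} (hl : ∀ k, ‖l k‖ = 1) (ω : Weights D) :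
    ‖objectiveGradient Hs v l ω‖ ≤ 2 * D := by
  rw [← sampleWeight_expectation hD hH l ω]
  refine (norm_sum_le _ _).trans ?_
  have : ∀ p : Coin K D × Bool, ‖sampleWeight Hs v l ω p • sampleValue p.1 p.2‖ =
      sampleWeight Hs v l ω p * (2 * D) := by
    intro p
    rw [norm_smul, norm_sampleValue, Real.norm_eq_abs,
      abs_of_nonneg (sampleWeight_nonneg hH v l ω p)]
  simp only [this]
  rw [← Finset.sum_mul, sampleWeight_sum hK hD hH hU hv hl, one_mul]

end Batches

/-! ### Projected gradient descent with inexact gradients -/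

section Descent

variable {n h K D : ℕ}

/-- One step of projected gradient descent with an inexact gradient contracts the distance to the
optimum up to the gradient error. -/
theorem projected_step_norm_le {E : Type*} [NormedAddCommGroup E] [InnerProductSpace ℝ E]
    {x xopt xnew g gopt g' : E} {μ M δ : ℝ} (hμ : 0 < μ) (hM : 0 < M)
    (hmono : μ * ‖x - xopt‖ ^ 2 ≤ inner ℝ (g - gopt) (x - xopt))
    (hlip : ‖g - gopt‖ ≤ M * ‖x - xopt‖) (herr : ‖g' - g‖ ≤ δ)
    (hproj : inner ℝ (x - (μ / M ^ 2) • g' - xnew) (xopt - xnew) ≤ 0)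
    (hopt : 0 ≤ inner ℝ gopt (xnew - xopt)) :
    ‖xnew - xopt‖ ≤ Real.sqrt (1 - μ ^ 2 / M ^ 2) * ‖x - xopt‖ + μ / M ^ 2 * δ := by
  set η := μ / M ^ 2 with hη
  have hη0 : 0 < η := by positivity
  set y := (x - xopt) - η • (g - gopt) with hy
  have hynorm : ‖y‖ ≤ Real.sqrt (1 - μ ^ 2 / M ^ 2) * ‖x - xopt‖ := by
    -- Expanding the square gives the factor `1 - 2ημ + η²M²`, which `η = μ/M²` minimizes.
    rw [← Real.sqrt_sq (norm_nonneg (x - xopt)), ← Real.sqrt_mul' _ (sq_nonneg _)]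
    refine Real.le_sqrt_of_sq_le ?_
    rw [hy, norm_sub_sq_real, norm_smul, inner_smul_right, Real.norm_eq_abs, abs_of_pos hη0,
      real_inner_comm]
    have h1 : (η * ‖g - gopt‖) ^ 2 ≤ η ^ 2 * (M ^ 2 * ‖x - xopt‖ ^ 2) := by
      rw [mul_pow, ← mul_pow M]
      gcongr
    have h2 := mul_le_mul_of_nonneg_left hmono hη0.le
    have h3 : η ^ 2 * (M ^ 2 * ‖x - xopt‖ ^ 2) = μ ^ 2 / M ^ 2 * ‖x - xopt‖ ^ 2 := by
      rw [hη]; field_simp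
    have h4 : η * (μ * ‖x - xopt‖ ^ 2) = μ ^ 2 / M ^ 2 * ‖x - xopt‖ ^ 2 := by
      rw [hη]; field_simp
    linarith
  -- The obtuse-angle property of the projection and first-order optimality both have the favourable
  -- sign.
  have hmain : ‖xnew - xopt‖ ^ 2 ≤ inner ℝ (y - η • (g' - g)) (xnew - xopt) := by
    have e1 : y - η • (g' - g) = (x - η • g' - xnew) + η • gopt + (xnew - xopt) := by
      rw [hy]; simp only [smul_sub]; abel
    rw [e1, inner_add_left, inner_add_left, real_inner_self_eq_norm_sq, inner_smul_left]
    have e2 : inner ℝ (x - η • g' - xnew) (xnew - xopt) =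
        - inner ℝ (x - η • g' - xnew) (xopt - xnew) := by
      rw [← inner_neg_right, neg_sub]
    have e3 : 0 ≤ η * inner ℝ gopt (xnew - xopt) := mul_nonneg hη0.le hopt
    simp only [conj_trivial]
    linarith
  have hcs := hmain.trans (real_inner_le_norm _ _)
  have hle : ‖xnew - xopt‖ ≤ ‖y - η • (g' - g)‖ := by
    rcases (norm_nonneg (xnew - xopt)).eq_or_lt with h0 | h0
    · rw [← h0]; exact norm_nonneg _
    · rw [sq] at hcs; exact le_of_mul_le_mul_right hcs h0
  refine hle.trans ((norm_sub_le _ _).trans (add_le_add hynorm ?_))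
  rw [norm_smul, Real.norm_eq_abs, abs_of_pos hη0]
  gcongr

/-- Strong convexity implies strong monotonicity of the gradient. -/
theorem StronglyConvexSmoothOn.inner_gradient_sub_ge {μ L : ℝ} {S : Set (Weights D)}
    {g : Weights D → ℝ} (hg : StronglyConvexSmoothOn μ L S g) {x y : Weights D} (hx : x ∈ S)
    (hy : y ∈ S) : μ * ‖x - y‖ ^ 2 ≤ inner ℝ (gradient g x - gradient g y) (x - y) := by
  have h1 := (hg x hx y hy).1
  have h2 := (hg y hy x hx).1
  have e : inner ℝ (gradient g x) (y - x) = - inner ℝ (gradient g x) (x - y) := by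
    rw [← inner_neg_right, neg_sub]
  rw [inner_sub_left]
  rw [norm_sub_rev y x, e] at h1
  linarith

/-- The first-order optimality condition. -/
theorem StronglyConvexSmoothOn.inner_gradient_nonneg {μ L R : ℝ} (hL : 0 < L) (hR : 0 < R)
    {S A : Set (Weights D)} (hA : Convex ℝ A) {g : Weights D → ℝ}
    (hg : StronglyConvexSmoothOn μ L S g) {x : Weights D} (hx : x ∈ A)
    (hAS : A ∩ Metric.closedBall x R ⊆ S) (hmin : IsMinOn g S x) {z : Weights D} (hz : z ∈ A) :
    0 ≤ inner ℝ (gradient g x) (z - x) := by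
  by_contra hneg
  push Not at hneg
  set d := z - x with hd
  set c := - inner ℝ (gradient g x) d with hc
  have hc0 : 0 < c := by rw [hc]; linarith
  have hxS : x ∈ S := hAS ⟨hx, Metric.mem_closedBall_self hR.le⟩
  -- The three bounds keep `x + t d` in `A`, keep it in the ball, and make the quadratic term
  -- smaller than the linear decrease `t c`.
  set t := min 1 (min (R / (‖d‖ + 1)) (c / (L * (‖d‖ ^ 2 + 1)))) with ht
  have ht0 : 0 < t := by
    rw [ht]; exact lt_min one_pos (lt_min (by positivity) (by positivity))
  have ht1 : t ≤ 1 := min_le_left _ _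
  have ht2 : t * (‖d‖ + 1) ≤ R := by
    rw [← le_div_iff₀ (by positivity)]; exact (min_le_right _ _).trans (min_le_left _ _)
  have ht3 : t * (L * (‖d‖ ^ 2 + 1)) ≤ c := by
    rw [← le_div_iff₀ (by positivity)]; exact (min_le_right _ _).trans (min_le_right _ _)
  have hyS : x + t • d ∈ S := by
    refine hAS ⟨hA.add_smul_sub_mem hx hz ⟨ht0.le, ht1⟩, ?_⟩
    rw [Metric.mem_closedBall, dist_eq_norm, add_sub_cancel_left, norm_smul, Real.norm_eq_abs,
      abs_of_pos ht0]
    nlinarith [norm_nonneg d]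
  have h1 := (hg x hxS _ hyS).2
  have h2 : g x ≤ g (x + t • d) := hmin hyS
  rw [add_sub_cancel_left, inner_smul_right, norm_smul, Real.norm_eq_abs, abs_of_pos ht0,
    mul_pow] at h1
  have h3 : t * c ≤ L / 2 * (t ^ 2 * ‖d‖ ^ 2) := by rw [hc]; linarith
  have h4 : t * (t * (L * (‖d‖ ^ 2 + 1))) ≤ t * c := mul_le_mul_of_nonneg_left ht3 ht0.le
  have h5 : 0 < L * t ^ 2 := by positivity
  nlinarith [sq_nonneg ‖d‖, mul_nonneg h5.le (sq_nonneg ‖d‖)]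

/-- Projected gradient descent for `T` steps of size `η`, with the gradient estimated from `m`
samples; `π` is the projection to the admissible weights and `s` the sign of the objective. -/
def descend (hK : 0 < K) (hD : 0 < D) {Hs : Fin D → Op n h}
    (hU : ∀ i, Hs i ∈ Matrix.unitaryGroup (Inp n × HidLab h) ℂ) (π : Weights D → Weights D)
    (η s : ℝ) (m : ℕ) : ℕ → Weights D → QueryAlgorithm n h K D Unit
  | 0, x => .output x
  | T + 1, x => batch hK hD hU x
      (fun z => descend hK hD hU π η s m T (π (x - η • ((s / m) • z)))) m 0

theorem queries_descend_le (hK : 0 < K) (hD : 0 < D) {Hs : Fin D → Op n h}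
    (hU : ∀ i, Hs i ∈ Matrix.unitaryGroup (Inp n × HidLab h) ℂ) (π : Weights D → Weights D)
    (η s : ℝ) (m T : ℕ) (x : Weights D) :
    (descend hK hD hU π η s m T x).queries ≤ 3 * m * T := by
  induction T generalizing x with
  | zero => simp [descend, QueryAlgorithm.queries]
  | succ T ih =>
    rw [descend, Nat.mul_succ]
    exact queries_batch_le hK hD hU x (fun z => ih _) m 0

theorem prob_output (F : Fin K → Matrix (Inp n × Fin 2) (Inp n × Fin 2) ℂ)
    (G : Fin K → Weights D → Matrix (HidLab h) (HidLab h) ℂ) {E : Set (Weights D)}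
    {x : Weights D} (hx : x ∈ E) :
    (QueryAlgorithm.output x : QueryAlgorithm n h K D Unit).prob F G E 1 = 1 := by
  simp [QueryAlgorithm.prob, hx]

-- A union bound over the steps: each fails to obtain a `δ`-accurate gradient with probability at
-- most `p`. Otherwise the iterate stays within `R`, and its distance either shrinks by `(1 + q)/2`
-- or is already within `ε` and remains so.
open scoped ComplexOrder in
theorem prob_descend_ge (hK : 0 < K) (hD : 0 < D) {Hs : Fin D → Op n h}
    (hH : ∀ i, (Hs i).IsHermitian)
    (hU : ∀ i, Hs i ∈ Matrix.unitaryGroup (Inp n × HidLab h) ℂ)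
    {v : Fin K → EuclideanSpace ℂ (Inp n)} (hv : ∀ k, ‖v k‖ = 1)
    {l : Fin K → EuclideanSpace ℂ (Fin 2)} (hl : ∀ k, ‖l k‖ = 1)
    {F : Fin K → Matrix (Inp n × Fin 2) (Inp n × Fin 2) ℂ} (hF : IsDataOracle v l F)
    {π : Weights D → Weights D} {η s : ℝ} {m : ℕ} (hm : 0 < m) {A : Set (Weights D)}
    (hπ : ∀ y, π y ∈ A) {ωopt : Weights D} {R ε q δ p : ℝ} (hε : 0 < ε) (hεR : ε ≤ R)
    (hq0 : 0 ≤ q) (hq1 : q < 1) (hδ : 0 < δ) (hp : (2 * D) ^ 2 ≤ p * (m * δ ^ 2))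
    (hstep : ∀ x ∈ A, ‖x - ωopt‖ ≤ R → ∀ z,
      ‖z - (m : ℝ) • objectiveGradient Hs v l x‖ ≤ m * δ →
      ‖π (x - η • ((s / m) • z)) - ωopt‖ ≤ q * ‖x - ωopt‖ + (1 - q) / 2 * ε)
    (T : ℕ) {x : Weights D} (hx : x ∈ A) (hxR : ‖x - ωopt‖ ≤ R)
    (hxT : ((1 + q) / 2) ^ T * ‖x - ωopt‖ ≤ ε) :
    1 - T * p ≤ (descend hK hD hU π η s m T x).prob F (gibbsOracle Hs v)
      {ω' | ‖ω' - ωopt‖ ≤ ε} 1 := by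
  have hm' : (0 : ℝ) < m := by exact_mod_cast hm
  have hp0 : 0 ≤ p := by
    by_contra hneg
    push Not at hneg
    have : p * (m * δ ^ 2) < 0 := mul_neg_of_neg_of_pos hneg (by positivity)
    nlinarith [sq_nonneg (2 * (D : ℝ))]
  induction T generalizing x with
  | zero =>
    rw [descend, prob_output]
    · simp
    · simpa using hxT
  | succ T ih =>
    set g := objectiveGradient Hs v l x with hg
    set E : Set (Weights D) := {ω' | ‖ω' - ωopt‖ ≤ ε}
    -- Chebyshev's inequality in pointwise form: for a bad sum `z` the left side is at most `0`, so
    -- nonnegativity of the probability suffices.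
    have hnext : ∀ z, (1 - T * p) - (1 / (m * δ) ^ 2) * ‖z - (m : ℝ) • g‖ ^ 2 ≤
        (descend hK hD hU π η s m T (π (x - η • ((s / m) • z)))).prob F
          (gibbsOracle Hs v) E 1 := by
      intro z
      by_cases hz : ‖z - (m : ℝ) • g‖ ≤ m * δ
      · have h1 := hstep x hx hxR z hz
        set d := ‖x - ωopt‖
        set d' := ‖π (x - η • ((s / m) • z)) - ωopt‖
        have h2 : 1 - T * p ≤ (descend hK hD hU π η s m T (π (x - η • ((s / m) • z)))).prob F
            (gibbsOracle Hs v) E 1 := by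
          have hd0 : 0 ≤ d' := norm_nonneg _
          have hpow0 : 0 ≤ ((1 + q) / 2) ^ T := by positivity
          have hpow1 : ((1 + q) / 2) ^ T ≤ 1 := pow_le_one₀ (by positivity) (by linarith)
          rcases le_total d ε with hdε | hdε
          · have hd' : d' ≤ ε := by nlinarith
            exact ih (hπ _) (hd'.trans hεR) (by nlinarith)
          · have hd' : d' ≤ (1 + q) / 2 * d := by nlinarith
            refine ih (hπ _) ?_ ?_
            · nlinarith
            · refine (mul_le_mul_of_nonneg_left hd' hpow0).trans ?_
              rw [← mul_assoc, ← pow_succ]; exact hxT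
        have h3 : 0 ≤ (1 / (m * δ) ^ 2) * ‖z - (m : ℝ) • g‖ ^ 2 := by positivity
        linarith
      · push Not at hz
        have h1 : 1 ≤ (1 / (m * δ) ^ 2) * ‖z - (m : ℝ) • g‖ ^ 2 := by
          rw [one_div, ← div_eq_inv_mul, one_le_div (by positivity)]
          gcongr
        have h2 : 0 ≤ T * p := by positivity
        have h3 := QueryAlgorithm.prob_nonneg F (fun k ω => gibbsOracle_posSemidef hH v k ω) E
          (descend hK hD hU π η s m T (π (x - η • ((s / m) • z)))) Matrix.PosSemidef.one
        linarith
    have h := prob_batch_ge hK hD hH hU hv hl hF E x _ (by positivity) hnext m 0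
    rw [descend]
    refine le_trans ?_ h
    have h1 : (1 / (m * δ) ^ 2) * (m * (2 * D) ^ 2) ≤ p := by
      rw [one_div, ← div_eq_inv_mul, div_le_iff₀ (by positivity)]
      nlinarith
    rw [← hg, zero_add, sub_self, norm_zero]
    push_cast
    linarith

end Descent

/-! ### Projection and choice of parameters -/

section Parameters

/-- The projection to a nonempty closed convex set, by its variational characterization. -/
theorem exists_projection {D : ℕ} {A : Set (Weights D)} (hne : A.Nonempty) (hc : IsClosed A)
    (hconv : Convex ℝ A) : ∃ π : Weights D → Weights D, (∀ y, π y ∈ A) ∧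
      ∀ y, ∀ z ∈ A, inner ℝ (y - π y) (z - π y) ≤ 0 := by
  have h : ∀ y, ∃ p ∈ A, ∀ z ∈ A, inner ℝ (y - p) (z - p) ≤ 0 := by
    intro y
    obtain ⟨p, hp, hmin⟩ := exists_norm_eq_iInf_of_complete_convex hne hc.isComplete hconv y
    exact ⟨p, hp, (norm_eq_iInf_iff_real_inner_le_zero hconv hp).mp hmin⟩
  choose π hπ using h
  exact ⟨π, fun y => (hπ y).1, fun y => (hπ y).2⟩

/-- The number of steps and of samples per step that suffice for accuracy `ε`, and the resulting
number of queries. -/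
theorem exists_steps_samples {r κ μ : ℝ} (hr0 : 0 < r) (hr1 : r < 1) (hκ : 0 < κ) (hμ : 0 < μ) :
    ∃ C : ℝ, 0 < C ∧ ∀ (D : ℕ) (ε R : ℝ), 0 < ε → ε < R → ε < 4 * D / μ →
      ∃ m T : ℕ, 0 < m ∧ 0 < T ∧ r ^ T * R ≤ ε ∧
        (2 * D : ℝ) ^ 2 ≤ 1 / (3 * T) * (m * (κ * ε) ^ 2) ∧
        ((3 * m * T : ℕ) : ℝ) ≤
          C * ((D : ℝ) ^ 2 / ε ^ 2) * (1 + Real.log (1 + R / ε)) ^ 2 := by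
  set a := - Real.log r with ha
  have ha0 : 0 < a := by rw [ha]; linarith [Real.log_neg hr0 hr1]
  -- The `2` absorbs the ceiling and the `+ 1` in `T`, because `ℓ ≥ 1`.
  set t := 1 / a + 2 with ht
  have ht0 : 0 < t := by positivity
  -- The first term is the required sample size. The second pays for rounding `m`: `ε < 4D/μ` forces
  -- `16/μ² · D²/ε² ≥ 1`.
  set B := 12 / κ ^ 2 + 32 / μ ^ 2 with hB
  have hB0 : 0 < B := by positivity
  refine ⟨3 * B * t ^ 2, by positivity, fun D ε R hε hεR hD => ?_⟩
  have hR : 0 < R := hε.trans hεR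
  have hratio : 0 < R / ε := by positivity
  set X := (D : ℝ) ^ 2 / ε ^ 2 with hX
  set ℓ := 1 + Real.log (1 + R / ε) with hℓ
  have hℓ1 : 1 ≤ ℓ := by
    have := Real.log_nonneg (x := 1 + R / ε) (by linarith)
    rw [hℓ]; linarith
  set T := ⌈Real.log (R / ε) / a⌉₊ + 1 with hT
  have hT1 : (1 : ℝ) ≤ T := by
    rw [hT]; push_cast; linarith [(⌈Real.log (R / ε) / a⌉₊).cast_nonneg (α := ℝ)]
  have hlog0 : 0 ≤ Real.log (R / ε) := Real.log_nonneg ((one_le_div hε).mpr hεR.le)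
  have hTle : (T : ℝ) ≤ t * ℓ := by
    have h1 := (Nat.ceil_lt_add_one (div_nonneg hlog0 ha0.le)).le
    have h2 : Real.log (R / ε) ≤ ℓ := by
      have := Real.log_le_log hratio (by linarith : R / ε ≤ 1 + R / ε)
      rw [hℓ]; linarith
    have h3 : Real.log (R / ε) / a ≤ 1 / a * ℓ := by
      rw [div_eq_inv_mul, one_div]; gcongr
    rw [hT, ht]; push_cast; nlinarith
  have hXpos : 1 ≤ 16 / μ ^ 2 * X := by
    have h1 : ε * μ < 4 * D := (lt_div_iff₀ hμ).mp hD
    have h2 : (ε * μ) ^ 2 ≤ (4 * D) ^ 2 := by gcongr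
    rw [hX, div_mul_div_comm, one_le_div (by positivity)]
    nlinarith
  set m := ⌈12 * D ^ 2 * T / (κ * ε) ^ 2⌉₊ + 1 with hm
  have hmle : (m : ℝ) ≤ B * X * T := by
    have h1 := (Nat.ceil_lt_add_one (a := 12 * (D : ℝ) ^ 2 * T / (κ * ε) ^ 2) (by positivity)).le
    have h2 : 12 * (D : ℝ) ^ 2 * T / (κ * ε) ^ 2 = 12 / κ ^ 2 * X * T := by
      rw [hX]; field_simp
    have h3 : 2 ≤ 32 / μ ^ 2 * X := by
      have : 32 / μ ^ 2 * X = 2 * (16 / μ ^ 2 * X) := by ring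
      linarith
    have h4 : 32 / μ ^ 2 * X ≤ 32 / μ ^ 2 * X * T := le_mul_of_one_le_right (by linarith) hT1
    rw [hm, hB]; push_cast
    rw [add_mul, add_mul]
    linarith
  refine ⟨m, T, Nat.succ_pos _, Nat.succ_pos _, ?_, ?_, ?_⟩
  · have h1 : Real.log (R / ε) ≤ a * T := by
      have h2 := Nat.le_ceil (Real.log (R / ε) / a)
      rw [div_le_iff₀ ha0] at h2
      rw [hT]; push_cast; nlinarith
    have h3 : r ^ T = Real.exp (-(a * T)) := by
      rw [ha, neg_mul, neg_neg, mul_comm, Real.exp_nat_mul, Real.exp_log hr0]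
    have h4 : Real.exp (-(a * T)) ≤ Real.exp (-Real.log (R / ε)) :=
      Real.exp_le_exp.mpr (by linarith)
    rw [Real.exp_neg (Real.log _), Real.exp_log hratio, inv_div] at h4
    rw [h3]
    exact (le_div_iff₀ hR).mp h4
  · have h1 : 12 * (D : ℝ) ^ 2 * T / (κ * ε) ^ 2 ≤ m := by
      rw [hm]; push_cast
      linarith [Nat.le_ceil (12 * (D : ℝ) ^ 2 * T / (κ * ε) ^ 2)]
    rw [div_le_iff₀ (by positivity)] at h1
    rw [one_div, ← div_eq_inv_mul, le_div_iff₀ (by positivity)]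
    linarith
  · push_cast
    have hX0 : 0 ≤ X := by positivity
    calc 3 * (m : ℝ) * T ≤ 3 * (B * X * T) * T := by gcongr
      _ = 3 * B * X * (T : ℝ) ^ 2 := by ring
      _ ≤ 3 * B * X * (t * ℓ) ^ 2 := by gcongr
      _ = 3 * B * t ^ 2 * X * ℓ ^ 2 := by ring

end Parameters

end

end HarmonyLearning

/-! ### The main theorem -/

open HarmonyLearning in
theorem mainTheorem3 (μ L Lip : ℝ) (hμ : 0 < μ) (hμL : μ < L) (hLip : 0 ≤ Lip) :
    ∃ C : ℝ, 0 < C ∧ ∃ c : ℕ,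
      ∀ (n h K D : ℕ), 0 < K →
      ∀ Hs : Fin D → HarmonyLearning.Op n h,
        (∀ i, (Hs i).IsHermitian) →
        (∀ i, Hs i ∈ Matrix.unitaryGroup
          (HarmonyLearning.Inp n × HarmonyLearning.HidLab h) ℂ) →
      ∀ s : ℝ, s = 1 ∨ s = -1 →
      ∀ A : Set (HarmonyLearning.Weights D), IsClosed A → Convex ℝ A →
      ∀ ω₀ ∈ A, ∀ ε : ℝ, 0 < ε → ∀ R : ℝ, 0 ≤ R →
      -- the algorithm is chosen before the training data and the oracles
      ∃ alg : HarmonyLearning.QueryAlgorithm n h K D Unit,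
        (alg.queries : ℝ) ≤
          C * ((D : ℝ) ^ 2 / ε ^ 2 *
            (R / ε) ^ (Real.log (1 + Lip / L) / Real.log (L / (L - μ)))) *
            (1 + Real.log (1 + R / ε)) ^ c ∧
        ∀ (v : Fin K → EuclideanSpace ℂ (HarmonyLearning.Inp n))
          (l : Fin K → EuclideanSpace ℂ (Fin 2)),
          (∀ k, ‖v k‖ = 1) → (∀ k, ‖l k‖ = 1) →
          (∀ k i, Commute (HarmonyLearning.labelProj n h (l k)) (Hs i)) →
        ∀ F : Fin K → Matrix (HarmonyLearning.Inp n × Fin 2) (HarmonyLearning.Inp n × Fin 2) ℂ,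
          HarmonyLearning.IsDataOracle v l F →
        ∀ (S : Set (HarmonyLearning.Weights D)) (ωopt : HarmonyLearning.Weights D),
          IsCompact S → ωopt ∈ A → ‖ωopt - ω₀‖ ≤ R →
          A ∩ Metric.closedBall ωopt R ⊆ S →
          IsMinOn (fun ω => s * HarmonyLearning.objective Hs v l ω) S ωopt →
          HarmonyLearning.StronglyConvexSmoothOn μ L S
            (fun ω => s * HarmonyLearning.objective Hs v l ω) →
          (∀ ω ∈ S, ∀ ω' ∈ S,
            ‖gradient (HarmonyLearning.objective Hs v l) ω -
              gradient (HarmonyLearning.objective Hs v l) ω'‖ ≤ Lip * ‖ω - ω'‖) →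
          2 / 3 ≤ alg.prob F (HarmonyLearning.gibbsOracle Hs v)
            {ω' | ‖ω' - ωopt‖ ≤ ε} 1 := by
  have hL : 0 < L := hμ.trans hμL
  -- A Lipschitz constant for the gradient, enlarged by `μ` so that `M > 0` and `μ/M ≤ 1` even when
  -- `Lip` is small.
  set M := μ + Lip with hM
  have hM0 : 0 < M := by positivity
  set q := Real.sqrt (1 - μ ^ 2 / M ^ 2) with hq
  have hq0 : 0 ≤ q := Real.sqrt_nonneg _
  have hq1 : q < 1 := by
    rw [hq, Real.sqrt_lt' one_pos]
    have : 0 < μ ^ 2 / M ^ 2 := by positivity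
    linarith
  set η := μ / M ^ 2 with hη
  have hη0 : 0 < η := by positivity
  -- A gradient error `κ ε` moves the iterate by `(1 - q)/2 · ε`, half of what the contraction gains
  -- at distance `ε`.
  set κ := (1 - q) / (2 * η) with hκ
  have hκ0 : 0 < κ := div_pos (by linarith) (by positivity)
  obtain ⟨C, hC, hpar⟩ := exists_steps_samples (r := (1 + q) / 2) (by linarith) (by linarith) hκ0 hμ
  -- One logarithm comes from `T`, the other from `m`, which grows with `T` through the union bound.
  refine ⟨C, hC, 2, ?_⟩
  intro n h K D hK Hs hH hU s hs A hAc hA ω₀ hω₀ ε hε R hR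
  have hs1 : |s| = 1 := by rcases hs with rfl | rfl <;> simp
  have hgrad : ∀ (v : Fin K → EuclideanSpace ℂ (Inp n)) (l : Fin K → EuclideanSpace ℂ (Fin 2)),
      (∀ k, ‖v k‖ = 1) → (∀ k i, Commute (labelProj n h (l k)) (Hs i)) → ∀ ω,
      gradient (objective Hs v l) ω = objectiveGradient Hs v l ω ∧
      gradient (fun ω => s * objective Hs v l ω) ω = s • objectiveGradient Hs v l ω := by
    intro v l hv hcomm ω
    have h1 := hasGradientAt_objective hH hv hcomm ω
    refine ⟨h1.gradient, HasGradientAt.gradient ?_⟩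
    rw [hasGradientAt_iff_hasFDerivAt, map_smul]
    exact h1.hasFDerivAt.const_mul s
  -- In these cases `ω₀` is already accurate enough. For the last, strong monotonicity and the
  -- gradient bound `2D` give `‖ωopt - ω₀‖ ≤ 4D/μ`.
  by_cases htriv : R ≤ ε ∨ D = 0 ∨ 4 * D / μ ≤ ε
  · refine ⟨.output ω₀, ?_, ?_⟩
    · have h1 : 0 ≤ Real.log (1 + R / ε) :=
        Real.log_nonneg (by have : 0 ≤ R / ε := by positivity
                            linarith)
      simp only [QueryAlgorithm.queries, Nat.cast_zero]
      positivity
    · intro v l hv hl hcomm F hF S ωopt _ hopt hR0 hAS hmin hconv _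
      rw [prob_output]
      · norm_num
      · rw [Set.mem_ofPred_eq, norm_sub_rev]
        rcases htriv with h1 | h1 | h1
        · exact hR0.trans h1
        · subst h1
          rw [Subsingleton.elim ωopt ω₀, sub_self, norm_zero]; exact hε.le
        · rcases Nat.eq_zero_or_pos D with rfl | hD
          · rw [Subsingleton.elim ωopt ω₀, sub_self, norm_zero]; exact hε.le
          have h2 := hconv.inner_gradient_sub_ge
            (hAS ⟨hopt, Metric.mem_closedBall_self hR⟩)
            (hAS ⟨hω₀, by rw [Metric.mem_closedBall, dist_eq_norm, norm_sub_rev]; exact hR0⟩)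
          rw [(hgrad v l hv hcomm _).2, (hgrad v l hv hcomm _).2, ← smul_sub] at h2
          have h3 := h2.trans (real_inner_le_norm _ _)
          rw [norm_smul, Real.norm_eq_abs, hs1, one_mul] at h3
          have h4 := (norm_sub_le (objectiveGradient Hs v l ωopt)
            (objectiveGradient Hs v l ω₀)).trans (add_le_add
              (norm_objectiveGradient_le hK hD hH hU hv hl ωopt)
              (norm_objectiveGradient_le hK hD hH hU hv hl ω₀))
          refine le_trans ?_ h1
          rw [le_div_iff₀ hμ]
          rcases (norm_nonneg (ωopt - ω₀)).eq_or_lt with h0 | h0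
          · rw [← h0]; simp
          · have h5 : μ * ‖ωopt - ω₀‖ ≤
                ‖objectiveGradient Hs v l ωopt - objectiveGradient Hs v l ω₀‖ := by
              refine le_of_mul_le_mul_right ?_ h0
              rw [mul_assoc, ← sq]; exact h3
            linarith
  · push Not at htriv
    obtain ⟨hεR, hD0, hDε⟩ := htriv
    have hD : 0 < D := Nat.pos_of_ne_zero hD0
    have hRpos : 0 < R := hε.trans hεR
    obtain ⟨π, hπA, hπ⟩ := exists_projection ⟨ω₀, hω₀⟩ hAc hA
    obtain ⟨m, T, hm, hT, hTR, hmT, hcost⟩ := hpar D ε R hε hεR hDε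
    have hm' : (0 : ℝ) < m := by exact_mod_cast hm
    have hT' : (0 : ℝ) < T := by exact_mod_cast hT
    refine ⟨descend hK hD hU π η s m T ω₀, ?_, ?_⟩
    · have hx : 1 ≤ (R / ε) ^ (Real.log (1 + Lip / L) / Real.log (L / (L - μ))) := by
        refine Real.one_le_rpow ((one_le_div hε).mpr hεR.le) (div_nonneg ?_ ?_)
        · refine Real.log_nonneg ?_
          have : 0 ≤ Lip / L := by positivity
          linarith
        · refine Real.log_nonneg ?_
          rw [one_le_div (by linarith)]; linarith
      refine (Nat.cast_le.mpr (queries_descend_le hK hD hU π η s m T ω₀)).trans (hcost.trans ?_)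
      have h1 : 0 ≤ Real.log (1 + R / ε) := by
        refine Real.log_nonneg ?_
        have : 0 ≤ R / ε := by positivity
        linarith
      gcongr
      exact le_mul_of_one_le_right (by positivity) hx
    · intro v l hv hl hcomm F hF S ωopt _ hopt hR0 hAS hmin hconv hlip
      have hball : ∀ x ∈ A, ‖x - ωopt‖ ≤ R → x ∈ S := fun x hx hxR =>
        hAS ⟨hx, by rw [Metric.mem_closedBall, dist_eq_norm]; exact hxR⟩
      have hoptS : ωopt ∈ S := hball ωopt hopt (by simpa using hR)
      have hstep : ∀ x ∈ A, ‖x - ωopt‖ ≤ R → ∀ z,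
          ‖z - (m : ℝ) • objectiveGradient Hs v l x‖ ≤ m * (κ * ε) →
          ‖π (x - η • ((s / m) • z)) - ωopt‖ ≤ q * ‖x - ωopt‖ + (1 - q) / 2 * ε := by
        intro x hx hxR z hz
        have hxS := hball x hx hxR
        have h1 := hconv.inner_gradient_sub_ge hxS hoptS
        rw [(hgrad v l hv hcomm _).2, (hgrad v l hv hcomm _).2] at h1
        have h2 := hlip x hxS ωopt hoptS
        rw [(hgrad v l hv hcomm _).1, (hgrad v l hv hcomm _).1] at h2
        have h3 : ‖s • objectiveGradient Hs v l x - s • objectiveGradient Hs v l ωopt‖ ≤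
            M * ‖x - ωopt‖ := by
          rw [← smul_sub, norm_smul, Real.norm_eq_abs, hs1, one_mul]
          refine h2.trans (mul_le_mul_of_nonneg_right ?_ (norm_nonneg _))
          rw [hM]; linarith
        have h4 : ‖(s / m) • z - s • objectiveGradient Hs v l x‖ ≤ κ * ε := by
          have : (s / m) • z - s • objectiveGradient Hs v l x =
              (s / m) • (z - (m : ℝ) • objectiveGradient Hs v l x) := by
            rw [smul_sub, smul_smul, div_mul_cancel₀ _ hm'.ne']
          rw [this, norm_smul, Real.norm_eq_abs, abs_div, hs1, abs_of_pos hm', one_div,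
            ← div_eq_inv_mul, div_le_iff₀ hm', mul_comm]
          exact hz
        have h5 := hconv.inner_gradient_nonneg hL hRpos hA hopt hAS hmin
          (hπA (x - η • ((s / m) • z)))
        rw [(hgrad v l hv hcomm _).2] at h5
        have h6 := projected_step_norm_le hμ hM0 h1 h3 h4
          (hπ (x - η • ((s / m) • z)) ωopt hopt) h5
        have h7 : η * (κ * ε) = (1 - q) / 2 * ε := by
          rw [hκ]; field_simp
        rw [← h7]; exact h6
      have hfin := prob_descend_ge hK hD hH hU hv hl hF hm hπA hε hεR.le hq0 hq1
        (by positivity : 0 < κ * ε) hmT hstep T hω₀ (by rw [norm_sub_rev]; exact hR0)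
        ((mul_le_mul_of_nonneg_left (by rw [norm_sub_rev]; exact hR0) (by positivity)).trans hTR)
      -- `T` steps, each failing with probability at most `1/(3T)`, leave success probability `2/3`.
      refine le_trans (le_of_eq ?_) hfin
      field_simp
      norm_num
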